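/- **Setting.** Let $V=\{1,\dots,d\}$ with $d\ge 1$. A *junction tree* on $V$ is a tree whose nodes (*clusters*) are subsets of $V$, none contained in another, which cover $V$, such that linked clusters intersect (the intersection is their *separator*) and every cluster on the path between clusters $A$ and $B$ contains $A\cap B$. It is a *$k$-th order cherry tree* if all clusters have $k$ elements and all separators have $k-1$ elements. A *cherry-vine structure* is a sequence $T_1,\dots,T_{d-1}$ in which $T_1$ is an ordinary tree on the vertex set $V$; $T_2$ is a second order cherry tree whose clusters are the edges $\{l,m\}$ of $T_1$; and, for $3\le k\le d-1$, $T_k$ is a $k$-th order cherry tree with $d-k+1$ clusters, each of which is the union of two linked clusters of $T_{k-1}$. (For $d=1$ the tree $T_1$ is the single vertex and contributes nothing.) Let $\mathbf X=(X_1,\dots,X_d)$ be a random vector with a joint density $f$ with respect to Lebesgue measure, with marginal densities $f_i$ and marginal distribution functions $F_i$. For $D\subset V$ and $j\in V\setminus D$, let $F_{j|D}(\cdot\,|\,\mathbf x_D)$ be the conditional distribution function of $X_j$ given $\mathbf X_D=\mathbf x_D$. For distinct $i,j\in V\setminus D$, let $C_{i,j|D}(\cdot,\cdot\,|\,\mathbf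 x_D)$ be the copula of the conditional distribution of $(X_i,X_j)$ given $\mathbf X_D=\mathbf x_D$, and $c_{i,j|D}$ a jointly measurable version of its density; for $D=\emptyset$ these are the unconditional objects $F_j$, $C_{i,j}$, $c_{i,j}$. **Theorem.** Let $T_1,\dots,T_{d-1}$ be a cherry-vine structure on $V$. The copulas $C_{i,j|D}$ and their densities $c_{i,j|D}$ exist, and for every choice of versions of them the following holds. 1. For Lebesgue-almost every $x=(x_1,\dots,x_d)\in\mathbb R^d$, $$f(x_1,\dots,x_d)=\Big[\prod_{i=1}^d f_i(x_i)\Big]\Big[\prod_{\{l,m\}\in E(T_1)}c_{l,m}\big(F_l(x_l),F_m(x_m)\big)\Big]\prod_{k=2}^{d-1}\ \prod_{\{A,B\}}c_{a,b|S}\big(F_{a|S}(x_a|\mathbf x_S),F_{b|S}(x_b|\mathbf x_S)\,\big|\,\mathbf x_S\big),$$ where $\{A,B\}$ runs over the pairs of linked clusters of $T_k$, with $S=A\cap B$, $A\setminus S=\{a\}$, $B\setminus S=\{b\}$ (each unordered pair $\{l,m\}$, respectively $\{a,b\}$, is listed once, with $l<m$, respectively $a<b$). 2. For every $D\subset V$,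 $i\in D$ and $j\in V\setminus D$, for almost every $\mathbf x_D$ with respect to the law of $\mathbf X_D$ and every $x_j\in\mathbb R$, the following partial derivative exists and $$F_{j|D}(x_j|\mathbf x_D)=\frac{\partial C_{i,j|D\setminus\{i\}}(u_i,u_j\,|\,\mathbf x_{D\setminus\{i\}})}{\partial u_i}\bigg|_{u_i=F_{i|D\setminus\{i\}}(x_i|\mathbf x_{D\setminus\{i\}}),\ u_j=F_{j|D\setminus\{i\}}(x_j|\mathbf x_{D\setminus\{i\}})}.$$ -/

import Mathlib

open MeasureTheory ProbabilityTheory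
open scoped ENNReal

/-- A junction tree on the vertex set `V`: a tree whose nodes are the clusters, no cluster being
contained in another one, the clusters covering `V`, linked clusters having a nonempty
intersection (their separator), and with the running intersection property: every cluster on the
path between `A` and `B` contains `A ∩ B`. -/
structure JunctionTree (V : Type*) [DecidableEq V] where
  clusters : Finset (Finset V)
  link : SimpleGraph {A : Finset V // A ∈ clusters}
  isTree : link.IsTree
  eq_of_subset : ∀ A ∈ clusters, ∀ B ∈ clusters, A ⊆ B → A = B
  cover : ∀ v : V, ∃ A ∈ clusters, v ∈ A
  separator_nonempty : ∀ A B, link.Adj A B → (A.1 ∩ B.1).Nonempty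
  running_intersection : ∀ A B (p : link.Walk A B), p.IsPath →
    ∀ K ∈ p.support, A.1 ∩ B.1 ⊆ K.1

/-- A `k`-th order cherry tree: all clusters have size `k`, all separators have size `k - 1`. -/
structure JunctionTree.IsCherry {V : Type*} [DecidableEq V] (T : JunctionTree V) (k : ℕ) :
    Prop where
  card_cluster : ∀ A ∈ T.clusters, A.card = k
  card_separator : ∀ A B, T.link.Adj A B → (A.1 ∩ B.1).card + 1 = k

/-- The cherry-vine structure `T₁, …, T_{d-1}` on `d` vertices. The tree `T₁` is `firstTree`, and
`T_k` is `tree k` for `2 ≤ k ≤ d - 1`; the other values of `tree` play no role. -/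
structure CherryVine (d : ℕ) where
  firstTree : SimpleGraph (Fin d)
  firstTree_isTree : firstTree.IsTree
  tree : ℕ → JunctionTree (Fin d)
  isCherry : ∀ k, 2 ≤ k → k + 1 ≤ d → (tree k).IsCherry k
  card_clusters : ∀ k, 2 ≤ k → k + 1 ≤ d → (tree k).clusters.card + k = d + 1
  clusters_two : 3 ≤ d → ∀ e : Finset (Fin d),
    e ∈ (tree 2).clusters ↔ ∃ l m, firstTree.Adj l m ∧ e = {l, m}
  clusters_succ : ∀ k, 2 ≤ k → k + 2 ≤ d → ∀ e ∈ (tree (k + 1)).clusters,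
    ∃ A B, (tree k).link.Adj A B ∧ e = A.1 ∪ B.1

open Classical in
/-- The edges `{l, m}` of a graph on `Fin d`, each listed once, as the pair `(l, m)`, `l < m`. -/
noncomputable def edgePairs {d : ℕ} (G : SimpleGraph (Fin d)) : Finset (Fin d × Fin d) :=
  Finset.univ.filter fun p => p.1 < p.2 ∧ G.Adj p.1 p.2

open Classical in
/-- The pairs of linked clusters `A`, `B` of a cherry tree, each listed once, as the triple
`(a, b, S)` with `S = A ∩ B`, `A \ S = {a}`, `B \ S = {b}` and `a < b`. -/
noncomputable def linkTriples {d : ℕ} (T : JunctionTree (Fin d)) :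
    Finset (Fin d × Fin d × Finset (Fin d)) :=
  Finset.univ.filter fun p => p.1 < p.2.1 ∧ ∃ A B, T.link.Adj A B ∧
    p.2.2 = A.1 ∩ B.1 ∧ A.1 \ p.2.2 = {p.1} ∧ B.1 \ p.2.2 = {p.2.1}

/-- A bivariate copula. Only the values on the unit square matter. -/
structure IsCopula (C : ℝ → ℝ → ℝ) : Prop where
  zero_left : ∀ v ∈ Set.Icc (0 : ℝ) 1, C 0 v = 0
  zero_right : ∀ u ∈ Set.Icc (0 : ℝ) 1, C u 0 = 0
  one_left : ∀ v ∈ Set.Icc (0 : ℝ) 1, C 1 v = v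
  one_right : ∀ u ∈ Set.Icc (0 : ℝ) 1, C u 1 = u
  two_increasing : ∀ u ∈ Set.Icc (0 : ℝ) 1, ∀ u' ∈ Set.Icc (0 : ℝ) 1,
    ∀ v ∈ Set.Icc (0 : ℝ) 1, ∀ v' ∈ Set.Icc (0 : ℝ) 1, u ≤ u' → v ≤ v' →
      0 ≤ C u' v' - C u' v - C u v' + C u v

/-- `C` is a copula of the probability measure `ν` on the plane: it couples the marginal
distribution functions of `ν` to the joint one. -/
def IsCopulaOf (C : ℝ → ℝ → ℝ) (ν : Measure (ℝ × ℝ)) : Prop :=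
  IsCopula C ∧ ∀ s t : ℝ,
    ν.real (Set.Iic s ×ˢ Set.Iic t) = C (cdf (ν.map Prod.fst) s) (cdf (ν.map Prod.snd) t)

/-- `c` is a density of the copula `C`. -/
def IsCopulaDensity (c : ℝ → ℝ → ℝ≥0∞) (C : ℝ → ℝ → ℝ) : Prop :=
  ∀ u ∈ Set.Icc (0 : ℝ) 1, ∀ v ∈ Set.Icc (0 : ℝ) 1,
    ENNReal.ofReal (C u v) = ∫⁻ s in Set.Icc 0 u, ∫⁻ t in Set.Icc 0 v, c s t

section Conditional

variable {d : ℕ} {Ω : Type*} [MeasurableSpace Ω]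

/-- `F_{j|D}(t | z)`, the conditional distribution function of `X_j` given `X_D = z`. -/
noncomputable def condDF (P : Measure Ω) [IsFiniteMeasure P] (X : Ω → Fin d → ℝ)
    (j : Fin d) (D : Finset (Fin d)) (t : ℝ) (z : D → ℝ) : ℝ :=
  cdf (condDistrib (fun ω => X ω j) (fun ω => D.restrict (X ω)) P z) t

/-- `C u v z = C_{i,j|D}(u, v | z)` is the conditional copula of `(X_i, X_j)` given `X_D = z`, for
almost every `z`. For `D = ∅` this is the copula of `(X_i, X_j)`. -/
def IsCondCopula (P : Measure Ω) [IsFiniteMeasure P] (X : Ω → Fin d → ℝ)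
    (i j : Fin d) (D : Finset (Fin d)) (C : ℝ → ℝ → (D → ℝ) → ℝ) : Prop :=
  ∀ᵐ z ∂(P.map fun ω => D.restrict (X ω)), IsCopulaOf (fun u v => C u v z)
    (condDistrib (fun ω => (X ω i, X ω j)) (fun ω => D.restrict (X ω)) P z)

/-- `C` and `c` are the conditional copulas `C_{i,j|D}` and (jointly measurable versions of) the
conditional copula densities `c_{i,j|D}` of the random vector `X`, for `i ≠ j` outside `D`. -/
structure IsPairCopulaFamily (P : Measure Ω) [IsFiniteMeasure P] (X : Ω → Fin d → ℝ)
    (C : Fin d → Fin d → (D : Finset (Fin d)) → ℝ → ℝ → (D → ℝ) → ℝ)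
    (c : Fin d → Fin d → (D : Finset (Fin d)) → ℝ → ℝ → (D → ℝ) → ℝ≥0∞) : Prop where
  isCondCopula : ∀ (i j : Fin d) (D : Finset (Fin d)), i ≠ j → i ∉ D → j ∉ D →
    IsCondCopula P X i j D (C i j D)
  measurable_density : ∀ (i j : Fin d) (D : Finset (Fin d)), i ≠ j → i ∉ D → j ∉ D →
    Measurable fun p : ℝ × ℝ × (D → ℝ) => c i j D p.1 p.2.1 p.2.2
  isDensity : ∀ (i j : Fin d) (D : Finset (Fin d)), i ≠ j → i ∉ D → j ∉ D →
    ∀ᵐ z ∂(P.map fun ω => D.restrict (X ω)),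
      IsCopulaDensity (fun u v => c i j D u v z) (fun u v => C i j D u v z)

end Conditional

/-! The density formula separates into an analytic identity between four marginal densities and a
combinatorial identity for set functions. Write f_D for the density of X_D. Given X_S, the law of
(X_a, X_b) has atomless marginals, so the probability integral transform makes them uniform, and the
law has density c_{a,b|S}(F_{a|S}, F_{b|S}) relative to the product of its marginals
(`eq_withDensity_copulaDensity`). Multiplying by the conditional densities gives, almost everywhere,
f_{S∪ab} f_S = f_{S∪a} f_{S∪b} c_{a,b|S} (`ae_marginalPDF_mul_eq`). Where the densities are
positive, log c_{a,b|S} is therefore the interaction φ(A ∪ B) + φ(A ∩ B) - φ(A) - φ(B) of φ = log f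
at A = S ∪ a, B = S ∪ b.

The rest is true of every set function with φ(∅) = 0 (`CherryVine.sum_decomposition`). Let Γ_k be
the sum of φ over the clusters of T_k minus the sum over its separators. The clusters of T_{k+1} are
the unions along the links of T_k. Its separators are the clusters A of T_k, each with multiplicity
deg A - 1, because the clusters of T_{k+1} containing A form a subtree with deg A nodes
(`IsCherryLevel.sum_separators`). Hence Γ_{k+1} - Γ_k is the sum of the interactions over the links
of T_k, and the sum telescopes from the singletons up to the single cluster V. Logarithms are
unavailable where f vanishes; there, if no factor on the right vanished, induction up the vine would
make f_V nonzero.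

For the recursion, C(·, v | z) is an indefinite integral of u ↦ ∫_0^v c(u, s | z) ds. Lebesgue
differentiation gives its derivative, and disintegration identifies the value with F_{j|D}
(`ae_condDistrib_Iic_eq_setLIntegral`). Each x_j costs a null set, so this is done for rational x_j
and extended by monotone increments and continuity (`hasDerivAt_of_forall_rat`). Since C need not be
measurable in z, the null sets are controlled through the integral of c and a derivative tested on
rational increments (`HasRatDerivAt`). -/

section ProbabilityIntegralTransform

/-! ### The probability integral transform for atomless laws. -/

variable (ν : Measure ℝ) [IsProbabilityMeasure ν] [NullSingletonClass ν]

theorem continuous_cdf : Continuous (cdf ν) := by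
  refine continuous_iff_continuousAt.2 fun x => ?_
  rw [(monotone_cdf ν).continuousAt_iff_leftLim_eq_rightLim, (cdf ν).rightLim_eq]
  have h : (cdf ν).measure {x} = 0 := by rw [measure_cdf]; exact measure_singleton x
  rw [StieltjesFunction.measure_singleton, ENNReal.ofReal_eq_zero] at h
  exact le_antisymm ((monotone_cdf ν).leftLim_le le_rfl) (by linarith)

/-- The two sets differ by a stretch on which the distribution function is constant, which carries
no mass. A bounded sublevel set contains its supremum by continuity; otherwise the value at `s` is
already 1. -/
theorem setOf_cdf_le_ae_eq_Iic (s : ℝ) : {x | cdf ν x ≤ cdf ν s} =ᵐ[ν] Set.Iic s := by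
  have hclosed : IsClosed {x | cdf ν x ≤ cdf ν s} :=
    isClosed_le (continuous_cdf ν) continuous_const
  have hsub : Set.Iic s ⊆ {x | cdf ν x ≤ cdf ν s} := fun x hx => monotone_cdf ν hx
  refine (ae_eq_of_subset_of_measure_ge hsub ?_
    measurableSet_Iic.nullMeasurableSet (measure_ne_top _ _)).symm
  rw [← ofReal_cdf ν s]
  by_cases h : ∃ b, cdf ν s < cdf ν b
  · obtain ⟨b, hb⟩ := h
    have hbdd : BddAbove {x | cdf ν x ≤ cdf ν s} :=
      ⟨b, fun x hx => le_of_lt ((monotone_cdf ν).reflect_lt (lt_of_le_of_lt hx hb))⟩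
    have hmem := hclosed.csSup_mem ⟨s, hsub Set.self_mem_Iic⟩ hbdd
    calc ν {x | cdf ν x ≤ cdf ν s} ≤ ν (Set.Iic (sSup {x | cdf ν x ≤ cdf ν s})) :=
          measure_mono fun x hx => le_csSup hbdd hx
      _ ≤ _ := by rw [← ofReal_cdf]; exact ENNReal.ofReal_le_ofReal hmem
  · push Not at h
    have h1 : 1 ≤ cdf ν s := le_of_tendsto (tendsto_cdf_atTop ν) (Filter.Eventually.of_forall h)
    exact prob_le_one.trans (by simpa using ENNReal.ofReal_le_ofReal h1)

/-- Interior levels are attained, by continuity. The levels 0 and 1 need not be: 1 is trivial and 0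
is a limit of levels decreasing to it. -/
theorem measure_setOf_cdf_le {u : ℝ} (h0 : 0 ≤ u) (h1 : u ≤ 1) :
    ν {x | cdf ν x ≤ u} = ENNReal.ofReal u := by
  have key : ∀ u, 0 < u → u < 1 → ν {x | cdf ν x ≤ u} = ENNReal.ofReal u := by
    intro u h0 h1
    obtain ⟨s, rfl⟩ : u ∈ Set.range (cdf ν) := mem_range_of_exists_le_of_exists_ge
      (continuous_cdf ν)
      (((tendsto_cdf_atBot ν).eventually (gt_mem_nhds h0)).exists.imp fun _ h => h.le)
      (((tendsto_cdf_atTop ν).eventually (lt_mem_nhds h1)).exists.imp fun _ h => h.le)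
    rw [measure_congr (setOf_cdf_le_ae_eq_Iic ν s), ofReal_cdf]
  rcases h1.eq_or_lt with rfl | h1
  · simp [cdf_le_one]
  rcases h0.eq_or_lt with rfl | h0
  · rw [ENNReal.ofReal_zero]
    refine le_antisymm (ge_of_tendsto (x := nhdsWithin (0 : ℝ) (Set.Ioi 0))
      (f := fun u => ENNReal.ofReal u) ?_ ?_) zero_le
    · have := (ENNReal.continuous_ofReal.tendsto 0).mono_left
        (nhdsWithin_le_nhds (s := Set.Ioi (0 : ℝ)))
      simpa using this
    · filter_upwards [Ioo_mem_nhdsGT (zero_lt_one' ℝ)] with u hu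
      rw [← key u hu.1 hu.2]
      exact measure_mono fun x hx => le_trans hx hu.1.le
  · exact key u h0 h1

/-- The probability integral transform. -/
theorem map_cdf_eq_restrict_volume : ν.map (cdf ν) = volume.restrict (Set.Icc 0 1) := by
  have hm : Measurable (cdf ν) := (continuous_cdf ν).measurable
  have : IsProbabilityMeasure (ν.map (cdf ν)) := Measure.isProbabilityMeasure_map hm.aemeasurable
  refine Measure.ext_of_Iic _ _ fun u => ?_
  rw [Measure.map_apply hm measurableSet_Iic, Measure.restrict_apply measurableSet_Iic]
  change ν {x | cdf ν x ≤ u} = _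
  rcases lt_or_ge u 0 with hu | h0
  · have h : Set.Iic u ∩ Set.Icc (0 : ℝ) 1 = ∅ := by
      ext x; simp only [Set.mem_inter_iff, Set.mem_Iic, Set.mem_Icc, Set.mem_empty_iff_false,
        iff_false]; rintro ⟨h, h', -⟩; linarith
    rw [h, measure_empty]
    convert measure_empty (μ := ν)
    ext x
    simp only [Set.mem_ofPred_eq, Set.mem_empty_iff_false, iff_false, not_le]
    exact hu.trans_le (cdf_nonneg ν x)
  rcases le_or_gt u 1 with h1 | h1
  · rw [measure_setOf_cdf_le ν h0 h1]
    have h : Set.Iic u ∩ Set.Icc (0 : ℝ) 1 = Set.Icc 0 u := by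
      ext x; simp only [Set.mem_inter_iff, Set.mem_Iic, Set.mem_Icc]
      exact ⟨fun h => ⟨h.2.1, h.1⟩, fun h => ⟨h.2, h.1, h.2.trans h1⟩⟩
    rw [h, Real.volume_Icc, sub_zero]
  · rw [Set.inter_eq_right.2 fun x hx => hx.2.trans h1.le]
    have h : {x | cdf ν x ≤ u} = Set.univ :=
      Set.eq_univ_of_forall fun x => (cdf_le_one ν x).trans h1.le
    rw [h, measure_univ, Real.volume_Icc]
    simp

theorem ae_cdf_mem_Ioo : ∀ᵐ x ∂ν, cdf ν x ∈ Set.Ioo (0 : ℝ) 1 := by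
  have hm : Measurable (cdf ν) := (continuous_cdf ν).measurable
  refine ae_of_ae_map hm.aemeasurable (p := fun u => u ∈ Set.Ioo (0 : ℝ) 1) ?_
  rw [map_cdf_eq_restrict_volume, ← restrict_Ioo_eq_restrict_Icc]
  exact ae_restrict_mem measurableSet_Ioo

theorem setLIntegral_Iic_comp_cdf {m : ℝ → ℝ≥0∞} (hm : Measurable m) (s : ℝ) :
    ∫⁻ x in Set.Iic s, m (cdf ν x) ∂ν = ∫⁻ u in Set.Icc 0 (cdf ν s), m u := by
  have hG : Measurable (cdf ν) := (continuous_cdf ν).measurable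
  rw [← Measure.restrict_congr_set (setOf_cdf_le_ae_eq_Iic ν s)]
  change ∫⁻ x in cdf ν ⁻¹' Set.Iic (cdf ν s), m (cdf ν x) ∂ν = _
  rw [← setLIntegral_map measurableSet_Iic hm hG, map_cdf_eq_restrict_volume,
    Measure.restrict_restrict measurableSet_Iic]
  congr 2
  ext x
  simp only [Set.mem_inter_iff, Set.mem_Iic, Set.mem_Icc]
  exact ⟨fun h => ⟨h.2.1, h.1⟩, fun h => ⟨h.2, h.1, h.2.trans (cdf_le_one ν s)⟩⟩

end ProbabilityIntegralTransform

/-! ### Laws on the plane, copulas and copula densities. -/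

theorem ext_of_Iic_prod (μ ν : Measure (ℝ × ℝ)) [IsFiniteMeasure μ]
    (h : ∀ s t, μ (Set.Iic s ×ˢ Set.Iic t) = ν (Set.Iic s ×ˢ Set.Iic t)) : μ = ν := by
  have hspan : IsCountablySpanning (Set.range (Set.Iic : ℝ → Set ℝ)) :=
    ⟨fun n : ℕ => Set.Iic (n : ℝ), fun n => ⟨n, rfl⟩, Set.eq_univ_of_forall
      fun x => Set.mem_iUnion.2 (exists_nat_ge x)⟩
  have hgen : (inferInstance : MeasurableSpace (ℝ × ℝ)) = MeasurableSpace.generateFrom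
      (Set.image2 (· ×ˢ ·) (Set.range Set.Iic) (Set.range Set.Iic)) :=
    (generateFrom_eq_prod ((borel_eq_generateFrom_Iic ℝ).symm.trans BorelSpace.measurable_eq.symm)
      ((borel_eq_generateFrom_Iic ℝ).symm.trans BorelSpace.measurable_eq.symm) hspan hspan).symm
  refine Measure.FiniteSpanningSetsIn.ext hgen (isPiSystem_Iic.prod isPiSystem_Iic)
    ⟨fun n : ℕ => Set.Iic (n : ℝ) ×ˢ Set.Iic (n : ℝ),
      fun n => Set.mem_image2_of_mem ⟨n, rfl⟩ ⟨n, rfl⟩, fun _ => measure_lt_top _ _, ?_⟩ ?_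
  · refine Set.eq_univ_of_forall fun p => Set.mem_iUnion.2 ?_
    obtain ⟨n, hn⟩ := exists_nat_ge (max p.1 p.2)
    exact ⟨n, (le_max_left _ _).trans hn, (le_max_right _ _).trans hn⟩
  · rintro _ ⟨_, ⟨s, rfl⟩, _, ⟨t, rfl⟩, rfl⟩
    exact h s t

theorem IsCopula.nonneg {C : ℝ → ℝ → ℝ} (hC : IsCopula C) {u v : ℝ}
    (hu : u ∈ Set.Icc (0 : ℝ) 1) (hv : v ∈ Set.Icc (0 : ℝ) 1) : 0 ≤ C u v := by
  have h0 : (0 : ℝ) ∈ Set.Icc (0 : ℝ) 1 := ⟨le_rfl, zero_le_one⟩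
  have h := hC.two_increasing 0 h0 u hu 0 h0 v hv hu.1 hv.1
  rw [hC.zero_right u hu, hC.zero_left v hv, hC.zero_left 0 h0] at h
  linarith

theorem IsCopula.monotoneOn_sub {C : ℝ → ℝ → ℝ} (hC : IsCopula C) {v v' : ℝ}
    (hv : v ∈ Set.Icc (0 : ℝ) 1) (hv' : v' ∈ Set.Icc (0 : ℝ) 1) (h : v ≤ v') :
    MonotoneOn (fun u => C u v' - C u v) (Set.Icc 0 1) := by
  intro u hu u' hu' huu'
  have := hC.two_increasing u hu u' hu' v hv v' hv' huu' h
  dsimp only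
  linarith

theorem cdf_mem_Icc (ν : Measure ℝ) (x : ℝ) : cdf ν x ∈ Set.Icc (0 : ℝ) 1 :=
  ⟨cdf_nonneg ν x, cdf_le_one ν x⟩

section Copula

variable {ν : Measure (ℝ × ℝ)} [IsProbabilityMeasure ν] {ν₁ ν₂ : Measure ℝ}
  [IsProbabilityMeasure ν₁] [IsProbabilityMeasure ν₂]
  [NullSingletonClass ν₁] [NullSingletonClass ν₂]
  {C : ℝ → ℝ → ℝ} {c : ℝ → ℝ → ℝ≥0∞}

/-- The joint density relative to the product of the marginals is the copula density evaluated at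
the marginal distribution functions. -/
theorem eq_withDensity_copulaDensity (h₁ : ν.map Prod.fst = ν₁) (h₂ : ν.map Prod.snd = ν₂)
    (hC : IsCopulaOf C ν) (hc : IsCopulaDensity c C) (hm : Measurable (Function.uncurry c)) :
    ν = (ν₁.prod ν₂).withDensity fun p => c (cdf ν₁ p.1) (cdf ν₂ p.2) := by
  have hG₁ : Measurable (cdf ν₁) := (continuous_cdf ν₁).measurable
  have hG₂ : Measurable (cdf ν₂) := (continuous_cdf ν₂).measurable
  have hm' : Measurable fun p : ℝ × ℝ => c (cdf ν₁ p.1) (cdf ν₂ p.2) :=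
    hm.comp ((hG₁.comp measurable_fst).prodMk (hG₂.comp measurable_snd))
  refine ext_of_Iic_prod _ _ fun s t => ?_
  rw [withDensity_apply _ (measurableSet_Iic.prod measurableSet_Iic),
    ← Measure.prod_restrict, lintegral_prod _ hm'.aemeasurable]
  simp only [setLIntegral_Iic_comp_cdf ν₂ (hm.of_uncurry_left)]
  have hm₂ : Measurable fun u => ∫⁻ v in Set.Icc 0 (cdf ν₂ t), c u v :=
    Measurable.lintegral_prod_right' hm
  rw [setLIntegral_Iic_comp_cdf ν₁ hm₂, ← hc _ (cdf_mem_Icc ν₁ s) _ (cdf_mem_Icc ν₂ t),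
    ← h₁, ← h₂, ← hC.2 s t, ofReal_measureReal]

/-- Lebesgue differentiation in `u` leaves out a Lebesgue-null set of the unit interval. Since `cdf
ν₁` is uniform under `ν₁`, the preimage of that set is `ν₁`-null. -/
theorem ae_hasDerivAt_copula (hC : IsCopula C) (hc : IsCopulaDensity c C)
    (hm : Measurable (Function.uncurry c)) (t : ℝ) :
    ∀ᵐ y ∂ν₁, HasDerivAt (fun u => C u (cdf ν₂ t))
      (∫⁻ w in Set.Iic t, c (cdf ν₁ y) (cdf ν₂ w) ∂ν₂).toReal (cdf ν₁ y) := by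
  have hG₁ : Measurable (cdf ν₁) := (continuous_cdf ν₁).measurable
  set v := cdf ν₂ t with hv
  have hvI : v ∈ Set.Icc (0 : ℝ) 1 := cdf_mem_Icc ν₂ t
  simp only [setLIntegral_Iic_comp_cdf ν₂ (hm.of_uncurry_left), ← hv]
  set m : ℝ → ℝ≥0∞ := fun u => ∫⁻ s in Set.Icc 0 v, c u s with hmdef
  have hmm : Measurable m := Measurable.lintegral_prod_right' hm
  have hmfin : ∫⁻ u in Set.Icc 0 1, m u ≠ ∞ := by
    rw [← hc 1 ⟨zero_le_one, le_rfl⟩ v hvI]; exact ENNReal.ofReal_ne_top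
  have hI : IntegrableOn (fun u => (m u).toReal) (Set.Icc 0 1) :=
    integrable_toReal_of_lintegral_ne_top hmm.aemeasurable hmfin
  have hII : IntervalIntegrable (fun u => (m u).toReal) volume 0 1 := by
    rw [intervalIntegrable_iff_integrableOn_Icc_of_le zero_le_one]; exact hI
  have hCu : ∀ u ∈ Set.Icc (0 : ℝ) 1, ∫ x in (0 : ℝ)..u, (m x).toReal = C u v := by
    intro u hu
    have hle : ∫⁻ x in Set.Icc 0 u, m x ≤ ∫⁻ x in Set.Icc 0 1, m x :=
      lintegral_mono_set (Set.Icc_subset_Icc_right hu.2)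
    rw [intervalIntegral.integral_of_le hu.1, ← integral_Icc_eq_integral_Ioc,
      integral_toReal hmm.aemeasurable
        (ae_lt_top hmm (lt_of_le_of_lt hle hmfin.lt_top).ne), ← hc u hu v hvI,
      ENNReal.toReal_ofReal (hC.nonneg hu hvI)]
  have hae : ∀ᵐ y ∂ν₁, cdf ν₁ y ∈ Set.uIcc (0 : ℝ) 1 → ∀ a ∈ Set.uIcc (0 : ℝ) 1,
      HasDerivAt (fun x => ∫ z in a..x, (m z).toReal) (m (cdf ν₁ y)).toReal (cdf ν₁ y) := by
    refine ae_of_ae_map hG₁.aemeasurable (p := fun x => x ∈ Set.uIcc (0 : ℝ) 1 →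
      ∀ a ∈ Set.uIcc (0 : ℝ) 1,
        HasDerivAt (fun x => ∫ z in a..x, (m z).toReal) (m x).toReal x) ?_
    rw [map_cdf_eq_restrict_volume]
    exact ae_restrict_of_ae hII.ae_hasDerivAt_integral
  filter_upwards [hae, ae_cdf_mem_Ioo ν₁] with y hy hyI
  have h01 : Set.uIcc (0 : ℝ) 1 = Set.Icc 0 1 := Set.uIcc_of_le zero_le_one
  refine (hy (by rw [h01]; exact Set.Ioo_subset_Icc_self hyI) 0
    (by rw [h01]; exact ⟨le_rfl, zero_le_one⟩)).congr_of_eventuallyEq ?_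
  -- `C` is controlled only on the unit square, so the base point has to be interior.
  filter_upwards [Ioo_mem_nhds hyI.1 hyI.2] with u hu
  exact (hCu u (Set.Ioo_subset_Icc_self hu)).symm

/-- The copula of a law on the plane with atomless marginals, as the joint distribution function
of the two probability integral transforms. -/
theorem isCopulaOf_map_cdf (h₁ : ν.map Prod.fst = ν₁) (h₂ : ν.map Prod.snd = ν₂) :
    IsCopulaOf (fun u v => (ν.map (Prod.map (cdf ν₁) (cdf ν₂))).real (Set.Iic u ×ˢ Set.Iic v))
      ν := by
  have hG₁ : Measurable (cdf ν₁) := (continuous_cdf ν₁).measurable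
  have hG₂ : Measurable (cdf ν₂) := (continuous_cdf ν₂).measurable
  have hG : Measurable (Prod.map (cdf ν₁) (cdf ν₂)) := hG₁.prodMap hG₂
  have hπ : IsProbabilityMeasure (ν.map (Prod.map (cdf ν₁) (cdf ν₂))) :=
    Measure.isProbabilityMeasure_map hG.aemeasurable
  have hap : ∀ u v, (ν.map (Prod.map (cdf ν₁) (cdf ν₂))) (Set.Iic u ×ˢ Set.Iic v) =
      ν (Prod.fst ⁻¹' {y | cdf ν₁ y ≤ u} ∩ Prod.snd ⁻¹' {w | cdf ν₂ w ≤ v}) := fun u v => by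
    rw [Measure.map_apply hG (measurableSet_Iic.prod measurableSet_Iic)]; rfl
  have hm₁ : ∀ u, MeasurableSet {y | cdf ν₁ y ≤ u} := fun u => hG₁ measurableSet_Iic
  have hm₂ : ∀ u, MeasurableSet {y | cdf ν₂ y ≤ u} := fun u => hG₂ measurableSet_Iic
  have hl : ∀ u ∈ Set.Icc (0 : ℝ) 1, ν (Prod.fst ⁻¹' {y | cdf ν₁ y ≤ u}) = ENNReal.ofReal u :=
    fun u hu => by
      rw [← Measure.map_apply measurable_fst (hm₁ u), h₁, measure_setOf_cdf_le ν₁ hu.1 hu.2]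
  have hr : ∀ u ∈ Set.Icc (0 : ℝ) 1, ν (Prod.snd ⁻¹' {y | cdf ν₂ y ≤ u}) = ENNReal.ofReal u :=
    fun u hu => by
      rw [← Measure.map_apply measurable_snd (hm₂ u), h₂, measure_setOf_cdf_le ν₂ hu.1 hu.2]
  have h0 : (0 : ℝ) ∈ Set.Icc (0 : ℝ) 1 := ⟨le_rfl, zero_le_one⟩
  have hone₁ : {y | cdf ν₁ y ≤ 1} = Set.univ := Set.eq_univ_of_forall fun y => cdf_le_one ν₁ y
  have hone₂ : {y | cdf ν₂ y ≤ 1} = Set.univ := Set.eq_univ_of_forall fun y => cdf_le_one ν₂ y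
  refine ⟨⟨fun v _ => ?_, fun u _ => ?_, fun v hv => ?_, fun u hu => ?_, ?_⟩, fun s t => ?_⟩
  · rw [measureReal_def, hap,
      measure_mono_null Set.inter_subset_left (by rw [hl 0 h0, ENNReal.ofReal_zero]),
      ENNReal.toReal_zero]
  · rw [measureReal_def, hap,
      measure_mono_null Set.inter_subset_right (by rw [hr 0 h0, ENNReal.ofReal_zero]),
      ENNReal.toReal_zero]
  · rw [measureReal_def, hap, hone₁, Set.preimage_univ, Set.univ_inter, hr v hv,
      ENNReal.toReal_ofReal hv.1]
  · rw [measureReal_def, hap, hone₂, Set.preimage_univ, Set.inter_univ, hl u hu,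
      ENNReal.toReal_ofReal hu.1]
  · intro u _ u' _ v _ v' _ huu hvv
    set π := ν.map (Prod.map (cdf ν₁) (cdf ν₂))
    have h := measureReal_union_add_inter (μ := π) (s := Set.Iic u' ×ˢ Set.Iic v)
      (t := Set.Iic u ×ˢ Set.Iic v') (measurableSet_Iic.prod measurableSet_Iic)
    rw [Set.prod_inter_prod, Set.inter_eq_right.2 (Set.Iic_subset_Iic.2 huu),
      Set.inter_eq_left.2 (Set.Iic_subset_Iic.2 hvv)] at h
    have h' : π.real (Set.Iic u' ×ˢ Set.Iic v ∪ Set.Iic u ×ˢ Set.Iic v') ≤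
        π.real (Set.Iic u' ×ˢ Set.Iic v') := measureReal_mono (Set.union_subset
      (Set.prod_mono_right (Set.Iic_subset_Iic.2 hvv))
      (Set.prod_mono_left (Set.Iic_subset_Iic.2 huu)))
    linarith
  · have e₁ : (Prod.fst ⁻¹' {y | cdf ν₁ y ≤ cdf ν₁ s} : Set (ℝ × ℝ)) =ᵐ[ν]
        Prod.fst ⁻¹' Set.Iic s := by
      have := setOf_cdf_le_ae_eq_Iic ν₁ s
      rw [← h₁] at this ⊢
      exact Measure.QuasiMeasurePreserving.preimage_ae_eq ⟨measurable_fst, .rfl⟩ this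
    have e₂ : (Prod.snd ⁻¹' {y | cdf ν₂ y ≤ cdf ν₂ t} : Set (ℝ × ℝ)) =ᵐ[ν]
        Prod.snd ⁻¹' Set.Iic t := by
      have := setOf_cdf_le_ae_eq_Iic ν₂ t
      rw [← h₂] at this ⊢
      exact Measure.QuasiMeasurePreserving.preimage_ae_eq ⟨measurable_snd, .rfl⟩ this
    rw [h₁, h₂]
    dsimp only
    rw [measureReal_def, measureReal_def, hap, measure_congr (e₁.inter e₂)]
    rfl

theorem isCopulaDensity_of_eq_withDensity {π : Measure (ℝ × ℝ)} [IsFiniteMeasure π]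
    (hm : Measurable (Function.uncurry c))
    (h : π = ((volume.restrict (Set.Icc (0 : ℝ) 1)).prod
      (volume.restrict (Set.Icc (0 : ℝ) 1))).withDensity (Function.uncurry c)) :
    IsCopulaDensity c fun u v => π.real (Set.Iic u ×ˢ Set.Iic v) := by
  have hset : ∀ u ∈ Set.Icc (0 : ℝ) 1, Set.Iic u ∩ Set.Icc (0 : ℝ) 1 = Set.Icc 0 u := by
    intro u hu
    ext x; simp only [Set.mem_inter_iff, Set.mem_Iic, Set.mem_Icc]
    exact ⟨fun h => ⟨h.2.1, h.1⟩, fun h => ⟨h.2, h.1, h.2.trans hu.2⟩⟩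
  intro u hu v hv
  rw [ofReal_measureReal, h, withDensity_apply _ (measurableSet_Iic.prod measurableSet_Iic),
    ← Measure.prod_restrict, lintegral_prod _ hm.aemeasurable,
    Measure.restrict_restrict measurableSet_Iic, Measure.restrict_restrict measurableSet_Iic,
    hset u hu, hset v hv]
  rfl

end Copula

/-- Derivatives along a dense set of parameters extend to all parameters when the family has
monotone increments and the derivative is continuous in the parameter. -/
theorem hasDerivAt_of_forall_rat {φ : ℝ → ℝ → ℝ} {L : ℝ → ℝ} {u₀ t : ℝ}
    (hu₀ : u₀ ∈ Set.Ioo (0 : ℝ) 1) (hq : ∀ q : ℚ, HasDerivAt (φ q) (L q) u₀)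
    (hmono : ∀ s s', s ≤ s' → MonotoneOn (fun u => φ s' u - φ s u) (Set.Icc 0 1))
    (hL : ContinuousAt L t) : HasDerivAt (φ t) (L t) u₀ := by
  -- Monotone increments make difference quotients monotone in the parameter, so those at `t` are
  -- squeezed between quotients at nearby rationals.
  have hslope : ∀ s s', s ≤ s' → ∀ᶠ u in nhdsWithin u₀ {u₀}ᶜ,
      slope (φ s) u₀ u ≤ slope (φ s') u₀ u := by
    intro s s' hs
    filter_upwards [nhdsWithin_le_nhds (Ioo_mem_nhds hu₀.1 hu₀.2), self_mem_nhdsWithin]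
      with u hu hne
    have hI := Set.Ioo_subset_Icc_self hu
    have hI₀ := Set.Ioo_subset_Icc_self hu₀
    rw [slope_def_field, slope_def_field]
    rcases lt_or_gt_of_ne (show u ≠ u₀ from hne) with h | h
    · have := hmono s s' hs hI hI₀ h.le
      dsimp only at this
      refine div_le_div_of_nonpos_of_le (by linarith) (by linarith)
    · have := hmono s s' hs hI₀ hI h.le
      dsimp only at this
      exact div_le_div_of_nonneg_right (by linarith) (by linarith)
  have hqs := fun q => hasDerivAt_iff_tendsto_slope.1 (hq q)
  rw [hasDerivAt_iff_tendsto_slope]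
  refine tendsto_order.2 ⟨fun a ha => ?_, fun a ha => ?_⟩
  · obtain ⟨l, hl, hlI⟩ := exists_Ioc_subset_of_mem_nhds (hL.eventually (lt_mem_nhds ha))
      ⟨t - 1, by linarith⟩
    obtain ⟨q, hlq, hqt⟩ := exists_rat_btwn hl
    filter_upwards [hslope q t hqt.le, (hqs q).eventually (lt_mem_nhds (hlI ⟨hlq, hqt.le⟩))]
      with u h h' using lt_of_lt_of_le h' h
  · obtain ⟨l, hl, hlI⟩ := exists_Ico_subset_of_mem_nhds (hL.eventually (gt_mem_nhds ha))
      ⟨t + 1, by linarith⟩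
    obtain ⟨q, htq, hql⟩ := exists_rat_btwn hl
    filter_upwards [hslope t q htq.le, (hqs q).eventually (gt_mem_nhds (hlI ⟨htq.le, hql⟩))]
      with u h h' using lt_of_le_of_lt h h'

/-! ### Disintegration and conditional densities. -/

section Disintegration

variable {Ω E β : Type*} [MeasurableSpace Ω] [MeasurableSpace E] [MeasurableSpace β]

/-- Split a null set `N` of the new product by whether its section over `z` is `m`-null. The `z`
with non-null section are negligible for the marginal of `ρ`; the remaining part of `N` is null for
`lam.prod m`, hence for `ρ`. -/
theorem absolutelyContinuous_fst_prod {ρ : Measure (E × β)} {lam : Measure E} {m : Measure β}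
    [SFinite lam] [SFinite m] [SFinite ρ] (h : ρ ≪ lam.prod m) : ρ ≪ (ρ.map Prod.fst).prod m := by
  refine Measure.AbsolutelyContinuous.mk fun N hN h0 => ?_
  have hms : Measurable fun z => m (Prod.mk z ⁻¹' N) := measurable_measure_prodMk_left hN
  have hB : MeasurableSet {z | m (Prod.mk z ⁻¹' N) ≠ 0} :=
    hms (measurableSet_singleton 0).compl
  have h1 : ρ (Prod.fst ⁻¹' {z | m (Prod.mk z ⁻¹' N) ≠ 0}) = 0 := by
    rw [← Measure.map_apply measurable_fst hB]
    exact (Measure.measure_prod_null hN).1 h0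
  have h2 : ρ (N \ Prod.fst ⁻¹' {z | m (Prod.mk z ⁻¹' N) ≠ 0}) = 0 := by
    refine h ((Measure.measure_prod_null (hN.diff (measurable_fst hB))).2 (ae_of_all _ fun z => ?_))
    by_cases hz : m (Prod.mk z ⁻¹' N) = 0
    · exact measure_mono_null (fun x hx => hx.1) hz
    · refine measure_mono_null (t := ∅) (fun x hx => ?_) measure_empty
      exact absurd hz hx.2
  refine measure_mono_null (fun x hx => ?_) (measure_union_null h1 h2)
  by_cases hx' : x ∈ Prod.fst ⁻¹' {z | m (Prod.mk z ⁻¹' N) ≠ 0}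
  · exact Or.inl hx'
  · exact Or.inr ⟨hx, hx'⟩

theorem withDensity_compProd_eq {lam : Measure E} {m : Measure β} [SFinite m]
    {g : E → ℝ≥0∞} (hg : Measurable g) {k : E → β → ℝ≥0∞}
    (hk : Measurable (Function.uncurry k)) {η : Kernel E β} [IsSFiniteKernel η]
    [SFinite (lam.withDensity g)] (h : ∀ᵐ z ∂lam.withDensity g, η z = m.withDensity (k z)) :
    lam.withDensity g ⊗ₘ η = (lam.prod m).withDensity fun p => g p.1 * k p.1 p.2 := by
  have hgk : Measurable fun p : E × β => g p.1 * k p.1 p.2 := (hg.comp measurable_fst).mul hk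
  ext s hs
  rw [Measure.compProd_apply hs, withDensity_apply _ hs, ← lintegral_indicator hs,
    lintegral_prod _ (hgk.indicator hs).aemeasurable,
    lintegral_congr_ae (g := fun z => ∫⁻ x in Prod.mk z ⁻¹' s, k z x ∂m)]
  · have hmeas : Measurable fun z => ∫⁻ x in Prod.mk z ⁻¹' s, k z x ∂m := by
      have : ∀ z, ∫⁻ x in Prod.mk z ⁻¹' s, k z x ∂m =
          ∫⁻ x, s.indicator (Function.uncurry k) (z, x) ∂m := fun z => by
        rw [← lintegral_indicator (measurable_prodMk_left hs)]; rfl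
      simp only [this]
      exact (hk.indicator hs).lintegral_prod_right'
    rw [lintegral_withDensity_eq_lintegral_mul _ hg hmeas]
    refine lintegral_congr fun z => ?_
    rw [Pi.mul_apply, ← lintegral_indicator (measurable_prodMk_left hs),
      ← lintegral_const_mul _ ((hk.of_uncurry_left).indicator (measurable_prodMk_left hs))]
    refine lintegral_congr fun x => ?_
    by_cases hx : (z, x) ∈ s
    · have hx' : x ∈ Prod.mk z ⁻¹' s := hx
      simp [hx, hx']
    · have hx' : x ∉ Prod.mk z ⁻¹' s := hx
      simp [hx, hx']
  · filter_upwards [h] with z hz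
    rw [hz, withDensity_apply _ (measurable_prodMk_left hs)]

variable [StandardBorelSpace β] [Nonempty β] {P : Measure Ω} [IsProbabilityMeasure P]
  {Z : Ω → E} {V : Ω → β} {lam : Measure E} {m : Measure β} [SigmaFinite lam] [SigmaFinite m]

theorem ae_condDistrib_absolutelyContinuous (hV : AEMeasurable V P)
    (h : P.map (fun ω => (Z ω, V ω)) ≪ lam.prod m) :
    ∀ᵐ z ∂P.map Z, condDistrib V Z P z ≪ m := by
  have h1 := absolutelyContinuous_fst_prod h
  have hfst : (P.map (fun ω => (Z ω, V ω))).map Prod.fst = P.map Z := Measure.fst_map_prodMk₀ hV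
  -- The constant kernel is built from the finite measure `m.toFinite`, which has the same null sets
  -- as `m`.
  have h2 : P.map Z ⊗ₘ condDistrib V Z P ≪ P.map Z ⊗ₘ Kernel.const E m.toFinite := by
    rw [compProd_map_condDistrib hV, Measure.compProd_const]
    rw [hfst] at h1
    exact h1.trans (Measure.AbsolutelyContinuous.rfl.prod (absolutelyContinuous_toFinite m))
  filter_upwards [h2.kernel_of_compProd] with z hz
  exact hz.trans (toFinite_absolutelyContinuous m)

/-- The Radon-Nikodym derivative of kernels supplies joint measurability, but relative to
`m.toFinite`; the factor `m.toFinite.rnDeriv m` converts it to a density relative to `m`. -/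
theorem exists_measurable_density_condDistrib (hV : AEMeasurable V P)
    (h : P.map (fun ω => (Z ω, V ω)) ≪ lam.prod m) :
    ∃ k : E → β → ℝ≥0∞, Measurable (Function.uncurry k) ∧
      ∀ᵐ z ∂P.map Z, condDistrib V Z P z = m.withDensity (k z) := by
  refine ⟨fun z x => m.toFinite.rnDeriv m x *
    Kernel.rnDeriv (condDistrib V Z P) (Kernel.const E m.toFinite) z x, ?_, ?_⟩
  · exact ((Measure.measurable_rnDeriv _ _).comp measurable_snd).mul
      (Kernel.measurable_rnDeriv _ _)
  · filter_upwards [ae_condDistrib_absolutelyContinuous hV h] with z hz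
    have hz' : condDistrib V Z P z ≪ Kernel.const E m.toFinite z :=
      hz.trans (absolutelyContinuous_toFinite m)
    have := Kernel.withDensity_rnDeriv_eq hz'
    rw [Kernel.withDensity_apply _ (Kernel.measurable_rnDeriv _ _)] at this
    rw [← this, Kernel.const_apply]
    have hr := Kernel.measurable_rnDeriv_right (condDistrib V Z P) (Kernel.const E m.toFinite) z
    generalize Kernel.rnDeriv (condDistrib V Z P) (Kernel.const E m.toFinite) z = r at hr ⊢
    have hmul := withDensity_mul m (Measure.measurable_rnDeriv m.toFinite m) hr
    rw [Measure.withDensity_rnDeriv_eq _ _ (toFinite_absolutelyContinuous m)] at hmul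
    exact hmul.symm

theorem pdf_prodMk_ae_eq (hZ : AEMeasurable Z P) (hV : AEMeasurable V P)
    (hZac : P.map Z ≪ lam) {k : E → β → ℝ≥0∞} (hk : Measurable (Function.uncurry k))
    (h : ∀ᵐ z ∂P.map Z, condDistrib V Z P z = m.withDensity (k z)) :
    pdf (fun ω => (Z ω, V ω)) P (lam.prod m) =ᵐ[lam.prod m]
      fun p => pdf Z P lam p.1 * k p.1 p.2 := by
  have hg : Measurable (pdf Z P lam) := measurable_pdf Z P lam
  have hZd : lam.withDensity (pdf Z P lam) = P.map Z := Measure.withDensity_rnDeriv_eq _ _ hZac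
  rw [← hZd] at h
  have : IsProbabilityMeasure (P.map Z) := Measure.isProbabilityMeasure_map hZ
  have : SFinite (lam.withDensity (pdf Z P lam)) := by rw [hZd]; infer_instance
  have h1 := withDensity_compProd_eq hg hk h
  rw [hZd, compProd_map_condDistrib hV] at h1
  rw [pdf_def, h1]
  exact Measure.rnDeriv_withDensity _ ((hg.comp measurable_fst).mul hk)

end Disintegration

theorem measurable_cdf_kernel {E : Type*} [MeasurableSpace E] (κ : Kernel E ℝ)
    [IsMarkovKernel κ] : Measurable fun p : E × ℝ => cdf (κ p.1) p.2 := by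
  simp only [cdf_eq_real, measureReal_def]
  refine Measurable.ennreal_toReal ?_
  have hs : MeasurableSet {q : (E × ℝ) × ℝ | q.2 ≤ q.1.2} :=
    measurableSet_le measurable_snd (measurable_snd.comp measurable_fst)
  exact Kernel.measurable_kernel_prodMk_left (κ := κ.comap Prod.fst measurable_fst) hs

theorem nullSingletonClass_of_absolutelyContinuous {ν : Measure ℝ} (h : ν ≪ volume) :
    NullSingletonClass ν := ⟨fun x => h (measure_singleton x)⟩

theorem map_comp_absolutelyContinuous {Ω α β : Type*} [MeasurableSpace Ω] [MeasurableSpace α]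
    [MeasurableSpace β] {P : Measure Ω} {X : Ω → α} {μ : Measure α} {ν : Measure β} {f : α → β}
    (hX : AEMeasurable X P) (h : P.map X ≪ μ) (hf : Measure.QuasiMeasurePreserving f μ ν) :
    P.map (fun ω => f (X ω)) ≪ ν := by
  have := (h.map hf.measurable).trans hf.absolutelyContinuous
  rwa [AEMeasurable.map_map_of_aemeasurable hf.measurable.aemeasurable hX] at this

/-- Replace one Lebesgue factor at a time by the corresponding marginal, exchanging the coordinates
in between. -/
theorem absolutelyContinuous_prod_marginals {ν : Measure (ℝ × ℝ)} [IsProbabilityMeasure ν]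
    (h : ν ≪ volume) : ν ≪ (ν.map Prod.fst).prod (ν.map Prod.snd) := by
  have : IsProbabilityMeasure (ν.map Prod.fst) :=
    Measure.isProbabilityMeasure_map measurable_fst.aemeasurable
  have : IsProbabilityMeasure (ν.map Prod.snd) :=
    Measure.isProbabilityMeasure_map measurable_snd.aemeasurable
  have h1 : ν ≪ (ν.map Prod.fst).prod volume := absolutelyContinuous_fst_prod h
  have h2 : ν.map Prod.swap ≪ (volume : Measure ℝ).prod (ν.map Prod.fst) := by
    have := h1.map measurable_swap
    rwa [Measure.prod_swap] at this
  have h3 := absolutelyContinuous_fst_prod h2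
  rw [Measure.map_map measurable_fst measurable_swap] at h3
  have h4 := h3.map measurable_swap
  rw [Measure.prod_swap, Measure.map_map measurable_swap measurable_swap] at h4
  rw [Prod.swap_swap_eq, Measure.map_id] at h4
  exact h4

/-! ### The conditional law of a pair: existence of copulas and the density identity. -/

section ConditionalPair

section Marginals

variable {Ω E : Type*} [MeasurableSpace Ω] [MeasurableSpace E]
  {P : Measure Ω} [IsProbabilityMeasure P] {Z : Ω → E} {Y W : Ω → ℝ}

theorem ae_map_fst_condDistrib (hY : AEMeasurable Y P) (hW : AEMeasurable W P) :
    ∀ᵐ z ∂P.map Z, (condDistrib (fun ω => (Y ω, W ω)) Z P z).map Prod.fst =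
      condDistrib Y Z P z := by
  filter_upwards [condDistrib_comp (μ := P) Z (hY.prodMk hW) measurable_fst] with z hz
  rw [Kernel.map_apply _ measurable_fst] at hz
  exact hz.symm

theorem ae_map_snd_condDistrib (hY : AEMeasurable Y P) (hW : AEMeasurable W P) :
    ∀ᵐ z ∂P.map Z, (condDistrib (fun ω => (Y ω, W ω)) Z P z).map Prod.snd =
      condDistrib W Z P z := by
  filter_upwards [condDistrib_comp (μ := P) Z (hY.prodMk hW) measurable_snd] with z hz
  rw [Kernel.map_apply _ measurable_snd] at hz
  exact hz.symm

end Marginals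

variable {Ω E : Type*} [MeasurableSpace Ω] [MeasureSpace E] [SigmaFinite (volume : Measure E)]
  {P : Measure Ω} {Z : Ω → E} {Y W : Ω → ℝ}

theorem quasiMeasurePreserving_prod_fst_mid : Measure.QuasiMeasurePreserving
    (fun p : E × (ℝ × ℝ) => (p.1, p.2.1)) volume volume :=
  MeasureTheory.QuasiMeasurePreserving.prodMap (Measure.QuasiMeasurePreserving.id volume)
    Measure.quasiMeasurePreserving_fst

theorem quasiMeasurePreserving_prod_fst_last : Measure.QuasiMeasurePreserving
    (fun p : E × (ℝ × ℝ) => (p.1, p.2.2)) volume volume :=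
  MeasureTheory.QuasiMeasurePreserving.prodMap (Measure.QuasiMeasurePreserving.id volume)
    Measure.quasiMeasurePreserving_snd

variable (hZ : AEMeasurable Z P) (hY : AEMeasurable Y P) (hW : AEMeasurable W P)
  (hac : P.map (fun ω => (Z ω, (Y ω, W ω))) ≪ volume)
include hZ hY hW hac

theorem map_fst_mid_absolutelyContinuous : P.map (fun ω => (Z ω, Y ω)) ≪ volume :=
  map_comp_absolutelyContinuous (hZ.prodMk (hY.prodMk hW)) hac quasiMeasurePreserving_prod_fst_mid

theorem map_fst_last_absolutelyContinuous : P.map (fun ω => (Z ω, W ω)) ≪ volume :=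
  map_comp_absolutelyContinuous (hZ.prodMk (hY.prodMk hW)) hac quasiMeasurePreserving_prod_fst_last

omit [SigmaFinite (volume : Measure E)] in
theorem map_fst_absolutelyContinuous : P.map Z ≪ volume :=
  map_comp_absolutelyContinuous (f := Prod.fst) (hZ.prodMk (hY.prodMk hW)) hac
    Measure.quasiMeasurePreserving_fst

variable [IsProbabilityMeasure P]

theorem ae_nullSingletonClass_condDistrib_left :
    ∀ᵐ z ∂P.map Z, NullSingletonClass (condDistrib Y Z P z) := by
  filter_upwards [ae_condDistrib_absolutelyContinuous hY
    (map_fst_mid_absolutelyContinuous hZ hY hW hac)] with z hz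
  exact nullSingletonClass_of_absolutelyContinuous hz

theorem ae_nullSingletonClass_condDistrib_right :
    ∀ᵐ z ∂P.map Z, NullSingletonClass (condDistrib W Z P z) := by
  filter_upwards [ae_condDistrib_absolutelyContinuous hW
    (map_fst_last_absolutelyContinuous hZ hY hW hac)] with z hz
  exact nullSingletonClass_of_absolutelyContinuous hz

/-- Conditional copulas with jointly measurable densities exist. -/
theorem exists_condCopula : ∃ (C : ℝ → ℝ → E → ℝ) (c : ℝ → ℝ → E → ℝ≥0∞),
    (Measurable fun p : ℝ × ℝ × E => c p.1 p.2.1 p.2.2) ∧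
    (∀ᵐ z ∂P.map Z, IsCopulaOf (fun u v => C u v z)
      (condDistrib (fun ω => (Y ω, W ω)) Z P z)) ∧
    ∀ᵐ z ∂P.map Z, IsCopulaDensity (fun u v => c u v z) (fun u v => C u v z) := by
  set κ := condDistrib (fun ω => (Y ω, W ω)) Z P with hκ
  set κ₁ := condDistrib Y Z P with hκ₁
  set κ₂ := condDistrib W Z P with hκ₂
  set I : Measure ℝ := volume.restrict (Set.Icc 0 1) with hI
  have hG : Measurable fun q : E × (ℝ × ℝ) => (cdf (κ₁ q.1) q.2.1, cdf (κ₂ q.1) q.2.2) :=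
    ((measurable_cdf_kernel κ₁).comp (measurable_fst.prodMk (measurable_fst.comp measurable_snd))).prodMk
    ((measurable_cdf_kernel κ₂).comp (measurable_fst.prodMk (measurable_snd.comp measurable_snd)))
  -- The conditional law of the two transformed variables; its joint distribution function will be
  -- the copula. Pairing with the identity kernel keeps `z` available to the transformation, which
  -- depends on it.
  set π : Kernel E (ℝ × ℝ) := (Kernel.id ×ₖ κ).map
    fun q : E × (ℝ × ℝ) => (cdf (κ₁ q.1) q.2.1, cdf (κ₂ q.1) q.2.2) with hπ
  have hπm : IsMarkovKernel π := Kernel.IsMarkovKernel.map _ hG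
  have hπz : ∀ z, π z = (κ z).map (Prod.map (cdf (κ₁ z)) (cdf (κ₂ z))) := by
    intro z
    rw [hπ, Kernel.map_apply _ hG, Kernel.prod_apply, Kernel.id_apply, Measure.dirac_prod,
      Measure.map_map hG measurable_prodMk_left]
    rfl
  set c : ℝ → ℝ → E → ℝ≥0∞ := fun u v z => Kernel.rnDeriv π (Kernel.const E (I.prod I)) z (u, v)
    with hc
  refine ⟨fun u v z => (π z).real (Set.Iic u ×ˢ Set.Iic v), c, ?_, ?_, ?_⟩
  · exact (Kernel.measurable_rnDeriv π (Kernel.const E (I.prod I))).comp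
      ((measurable_snd.comp measurable_snd).prodMk
        (measurable_fst.prodMk (measurable_fst.comp measurable_snd)))
  · filter_upwards [ae_map_fst_condDistrib (Z := Z) hY hW, ae_map_snd_condDistrib (Z := Z) hY hW,
      ae_nullSingletonClass_condDistrib_left hZ hY hW hac,
      ae_nullSingletonClass_condDistrib_right hZ hY hW hac] with z h₁ h₂ n₁ n₂
    rw [hπz]
    exact isCopulaOf_map_cdf h₁ h₂
  · filter_upwards [ae_map_fst_condDistrib (Z := Z) hY hW, ae_map_snd_condDistrib (Z := Z) hY hW,
      ae_nullSingletonClass_condDistrib_left hZ hY hW hac,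
      ae_nullSingletonClass_condDistrib_right hZ hY hW hac,
      ae_condDistrib_absolutelyContinuous (hY.prodMk hW) hac] with z h₁ h₂ n₁ n₂ hz
    have hm := Kernel.measurable_rnDeriv_right π (Kernel.const E (I.prod I)) z
    refine isCopulaDensity_of_eq_withDensity hm ?_
    -- The conditional law is dominated by the product of its marginals, and the transforms carry
    -- that product to the uniform law on the square.
    have hac' : π z ≪ Kernel.const E (I.prod I) z := by
      have := absolutelyContinuous_prod_marginals hz
      rw [h₁, h₂] at this
      have hG₁ : Measurable (cdf (κ₁ z)) := (continuous_cdf (κ₁ z)).measurable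
      have hG₂ : Measurable (cdf (κ₂ z)) := (continuous_cdf (κ₂ z)).measurable
      have := this.map (hG₁.prodMap hG₂)
      rw [← Measure.map_prod_map _ _ hG₁ hG₂, map_cdf_eq_restrict_volume,
        map_cdf_eq_restrict_volume] at this
      rw [hπz]
      exact this
    have := Kernel.withDensity_rnDeriv_eq hac'
    rw [Kernel.withDensity_apply _ (Kernel.measurable_rnDeriv _ _)] at this
    exact this.symm

variable {C : ℝ → ℝ → E → ℝ} {c : ℝ → ℝ → E → ℝ≥0∞}
  (hm : Measurable fun p : ℝ × ℝ × E => c p.1 p.2.1 p.2.2)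
  (hC : ∀ᵐ z ∂P.map Z, IsCopulaOf (fun u v => C u v z)
    (condDistrib (fun ω => (Y ω, W ω)) Z P z))
  (hc : ∀ᵐ z ∂P.map Z, IsCopulaDensity (fun u v => c u v z) (fun u v => C u v z))
include hm hC hc

theorem ae_condDistrib_eq_withDensity_copulaDensity : ∀ᵐ z ∂P.map Z,
    condDistrib (fun ω => (Y ω, W ω)) Z P z =
      ((condDistrib Y Z P z).prod (condDistrib W Z P z)).withDensity
        fun p => c (cdf (condDistrib Y Z P z) p.1) (cdf (condDistrib W Z P z) p.2) z := by
  filter_upwards [ae_map_fst_condDistrib (Z := Z) hY hW, ae_map_snd_condDistrib (Z := Z) hY hW,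
    ae_nullSingletonClass_condDistrib_left hZ hY hW hac,
    ae_nullSingletonClass_condDistrib_right hZ hY hW hac, hC, hc] with z h₁ h₂ n₁ n₂ hCz hcz
  exact eq_withDensity_copulaDensity (c := fun u v => c u v z) h₁ h₂ hCz hcz
    (hm.comp (measurable_fst.prodMk (measurable_snd.prodMk measurable_const)))

/-- The pair-copula identity for the joint density of `(Z, Y, W)`. -/
theorem ae_pdf_mul_pdf_eq : ∀ᵐ p : E × (ℝ × ℝ),
    pdf (fun ω => (Z ω, (Y ω, W ω))) P volume p * pdf Z P volume p.1 =
      pdf (fun ω => (Z ω, Y ω)) P volume (p.1, p.2.1) *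
      pdf (fun ω => (Z ω, W ω)) P volume (p.1, p.2.2) *
      c (cdf (condDistrib Y Z P p.1) p.2.1) (cdf (condDistrib W Z P p.1) p.2.2) p.1 := by
  obtain ⟨k₁, hk₁, e₁⟩ := exists_measurable_density_condDistrib hY
    (map_fst_mid_absolutelyContinuous hZ hY hW hac)
  obtain ⟨k₂, hk₂, e₂⟩ := exists_measurable_density_condDistrib hW
    (map_fst_last_absolutelyContinuous hZ hY hW hac)
  have hZac := map_fst_absolutelyContinuous hZ hY hW hac
  have h₁ := quasiMeasurePreserving_prod_fst_mid.ae (pdf_prodMk_ae_eq hZ hY hZac hk₁ e₁)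
  have h₂ := quasiMeasurePreserving_prod_fst_last.ae (pdf_prodMk_ae_eq hZ hW hZac hk₂ e₂)
  have hG₁ := measurable_cdf_kernel (condDistrib Y Z P)
  have hG₂ := measurable_cdf_kernel (condDistrib W Z P)
  have hcm : Measurable fun q : E × (ℝ × ℝ) => c (cdf (condDistrib Y Z P q.1) q.2.1)
      (cdf (condDistrib W Z P q.1) q.2.2) q.1 :=
    hm.comp ((hG₁.comp (measurable_fst.prodMk (measurable_fst.comp measurable_snd))).prodMk
      ((hG₂.comp (measurable_fst.prodMk (measurable_snd.comp measurable_snd))).prodMk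
        measurable_fst))
  have hk₁' : Measurable fun q : E × (ℝ × ℝ) => k₁ q.1 q.2.1 :=
    hk₁.comp (measurable_fst.prodMk (measurable_fst.comp measurable_snd))
  have hk₂' : Measurable fun q : E × (ℝ × ℝ) => k₂ q.1 q.2.2 :=
    hk₂.comp (measurable_fst.prodMk (measurable_snd.comp measurable_snd))
  -- The conditional density of the pair is the product of the two conditional densities and the
  -- copula density.
  have h₃ := pdf_prodMk_ae_eq (m := (volume : Measure (ℝ × ℝ))) hZ (hY.prodMk hW) hZac
    (k := fun z p => k₁ z p.1 * k₂ z p.2 *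
      c (cdf (condDistrib Y Z P z) p.1) (cdf (condDistrib W Z P z) p.2) z)
    ((hk₁'.mul hk₂').mul hcm) (by
      filter_upwards [ae_condDistrib_eq_withDensity_copulaDensity hZ hY hW hac hm hC hc, e₁, e₂]
        with z hz e₁ e₂
      have hs₁ : SFinite (volume.withDensity (k₁ z)) := by rw [← e₁]; infer_instance
      have hs₂ : SFinite (volume.withDensity (k₂ z)) := by rw [← e₂]; infer_instance
      have hmul := withDensity_mul (volume : Measure (ℝ × ℝ))
        (f := fun p => k₁ z p.1 * k₂ z p.2)
        (g := fun p => c (cdf (condDistrib Y Z P z) p.1) (cdf (condDistrib W Z P z) p.2) z)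
        ((hk₁'.mul hk₂').comp measurable_prodMk_left) (hcm.comp measurable_prodMk_left)
      refine hz.trans (Eq.trans ?_ hmul.symm)
      congr 1
      rw [e₁, e₂, prod_withDensity hk₁.of_uncurry_left hk₂.of_uncurry_left]
      rfl)
  filter_upwards [h₁, h₂, h₃] with p h₁ h₂ h₃
  -- Both sides are f_Z² k₁ k₂ c. The multiplied form avoids division by a possibly vanishing f_Z.
  refine (congrArg (· * _) h₃).trans (Eq.trans ?_ (congrArg (· * _) (congrArg₂ (· * ·) h₁ h₂)).symm)
  ring

end ConditionalPair

/-! ### Measurability of differentiability. -/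

/-- A version of `HasDerivAt` that only tests rational increments. -/
def HasRatDerivAt (f : ℝ → ℝ) (L u : ℝ) : Prop :=
  ∀ n : ℕ, ∃ m : ℕ, ∀ h : ℚ, |(h : ℝ)| < 1 / ((m : ℝ) + 1) →
    |f (u + h) - f u - h * L| ≤ 1 / ((n : ℝ) + 1) * |(h : ℝ)|

theorem HasDerivAt.hasRatDerivAt {f : ℝ → ℝ} {L u : ℝ} (h : HasDerivAt f L u) :
    HasRatDerivAt f L u := by
  intro n
  have h1 := (hasDerivAt_iff_isLittleO_nhds_zero.1 h).bound
    (show (0 : ℝ) < 1 / ((n : ℝ) + 1) by positivity)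
  obtain ⟨δ, hδ, hδ'⟩ := Metric.eventually_nhds_iff.1 h1
  obtain ⟨m, hm⟩ := exists_nat_one_div_lt hδ
  refine ⟨m, fun q hq => ?_⟩
  have := hδ' (y := (q : ℝ)) (by rw [Real.dist_eq, sub_zero]; exact hq.trans hm)
  rwa [smul_eq_mul, Real.norm_eq_abs, Real.norm_eq_abs] at this

/-- Near 0 both sides of the tested inequality are continuous in the increment, so it passes from
the dense rationals to all real increments. -/
theorem HasRatDerivAt.hasDerivAt {f : ℝ → ℝ} {L u : ℝ} {s : Set ℝ} (hs : s ∈ nhds u)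
    (hf : ContinuousOn f s) (h : HasRatDerivAt f L u) : HasDerivAt f L u := by
  rw [hasDerivAt_iff_isLittleO_nhds_zero]
  refine Asymptotics.isLittleO_iff.2 fun ε hε => ?_
  obtain ⟨n, hn⟩ := exists_nat_one_div_lt hε
  obtain ⟨m, hm⟩ := h n
  have hs' : ∀ᶠ x : ℝ in nhds 0, s ∈ nhds (u + x) := by
    have hc : ContinuousAt (fun x : ℝ => u + x) 0 := by fun_prop
    have := eventually_mem_nhds_iff.2 hs
    rw [show u = u + 0 by ring] at this
    simpa using hc.eventually this
  have hball : ∀ᶠ x : ℝ in nhds 0, |x| < 1 / ((m : ℝ) + 1) := by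
    have : Metric.ball (0 : ℝ) (1 / ((m : ℝ) + 1)) ∈ nhds (0 : ℝ) :=
      Metric.ball_mem_nhds _ (by positivity)
    filter_upwards [this] with x hx
    simpa [Real.norm_eq_abs] using hx
  filter_upwards [hs', hball] with x hx hxm
  have hne : (nhdsWithin x (Set.range ((↑) : ℚ → ℝ))).NeBot :=
    mem_closure_iff_nhdsWithin_neBot.1 (Rat.denseRange_cast x)
  have hfx : ContinuousAt f (u + x) := hf.continuousAt hx
  have hc : ContinuousAt (fun y : ℝ => |f (u + y) - f u - y * L|) x := by
    have : ContinuousAt (fun y : ℝ => f (u + y)) x :=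
      ContinuousAt.comp' (f := fun y => u + y) hfx (by fun_prop)
    fun_prop
  have hc' : ContinuousAt (fun y : ℝ => 1 / ((n : ℝ) + 1) * |y|) x := by fun_prop
  have hle : |f (u + x) - f u - x * L| ≤ 1 / ((n : ℝ) + 1) * |x| := by
    refine le_of_tendsto_of_tendsto
      (b := nhdsWithin x (Set.range ((↑) : ℚ → ℝ))) (hc.mono_left nhdsWithin_le_nhds)
      (hc'.mono_left nhdsWithin_le_nhds) ?_
    filter_upwards [self_mem_nhdsWithin, nhdsWithin_le_nhds
      ((continuous_abs.continuousAt (x := x)).eventually (gt_mem_nhds hxm))] with y hy hy'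
    obtain ⟨q, rfl⟩ := hy
    exact hm q hy'
  rw [smul_eq_mul, Real.norm_eq_abs, Real.norm_eq_abs]
  exact hle.trans (mul_le_mul_of_nonneg_right hn.le (abs_nonneg x))

/-- The quantifiers over `n`, `m` and the rational increment are countable; this is the purpose of
the rational test. -/
theorem measurableSet_hasRatDerivAt {α : Type*} [MeasurableSpace α] {φ : α → ℝ → ℝ}
    {L G : α → ℝ} (hφ : Measurable (Function.uncurry φ)) (hL : Measurable L)
    (hG : Measurable G) : MeasurableSet {p | HasRatDerivAt (φ p) (L p) (G p)} := by
  simp only [HasRatDerivAt, Set.ofPred_forall, Set.ofPred_exists]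
  refine MeasurableSet.iInter fun n => MeasurableSet.iUnion fun m => MeasurableSet.iInter fun h =>
    MeasurableSet.iInter fun _ => ?_
  have h1 : Measurable fun p => φ p (G p + h) := hφ.comp (measurable_id.prodMk (hG.add_const _))
  have h2 : Measurable fun p => φ p (G p) := hφ.comp (measurable_id.prodMk hG)
  have h3 : Measurable fun p => |φ p (G p + h) - φ p (G p) - h * L p| :=
    ((h1.sub h2).sub (hL.const_mul _)).norm
  exact measurableSet_le h3 measurable_const

/-- The rectangle inequality over heights [0, v] and [v, 1], with the boundary values, bounds the
increment in `u` between 0 and the length of the step. So the function is 1-Lipschitz. -/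
theorem IsCopula.continuousOn_left {C : ℝ → ℝ → ℝ} (hC : IsCopula C) {v : ℝ}
    (hv : v ∈ Set.Icc (0 : ℝ) 1) : ContinuousOn (fun u => C u v) (Set.Icc 0 1) := by
  have h0 : (0 : ℝ) ∈ Set.Icc (0 : ℝ) 1 := ⟨le_rfl, zero_le_one⟩
  have h1 : (1 : ℝ) ∈ Set.Icc (0 : ℝ) 1 := ⟨zero_le_one, le_rfl⟩
  have key : ∀ x ∈ Set.Icc (0 : ℝ) 1, ∀ y ∈ Set.Icc (0 : ℝ) 1, x ≤ y →
      |C x v - C y v| ≤ |x - y| := by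
    intro x hx y hy hxy
    have a := hC.two_increasing x hx y hy v hv 1 h1 hxy hv.2
    have b := hC.two_increasing x hx y hy 0 h0 v hv hxy hv.1
    rw [hC.one_right x hx, hC.one_right y hy] at a
    rw [hC.zero_right x hx, hC.zero_right y hy] at b
    rw [abs_le, abs_of_nonpos (by linarith : x - y ≤ 0)]
    constructor <;> linarith
  have hlip : LipschitzOnWith 1 (fun u => C u v) (Set.Icc 0 1) := by
    refine LipschitzOnWith.of_dist_le_mul fun x hx y hy => ?_
    rw [NNReal.coe_one, one_mul, Real.dist_eq, Real.dist_eq]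
    rcases le_total x y with h | h
    · exact key x hx y hy h
    · rw [abs_sub_comm, abs_sub_comm x]; exact key y hy x hx h
  exact hlip.continuousOn

theorem measurable_setLIntegral_Icc {α : Type*} [MeasurableSpace α] {g : α → ℝ → ℝ≥0∞}
    (hg : Measurable (Function.uncurry g)) {b : α → ℝ} (hb : Measurable b) :
    Measurable fun a => ∫⁻ s in Set.Icc 0 (b a), g a s := by
  have hs : MeasurableSet {p : α × ℝ | 0 ≤ p.2 ∧ p.2 ≤ b p.1} :=
    (measurableSet_le measurable_const measurable_snd).inter
      (measurableSet_le measurable_snd (hb.comp measurable_fst))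
  have : ∀ a, ∫⁻ s in Set.Icc 0 (b a), g a s =
      ∫⁻ s, {p : α × ℝ | 0 ≤ p.2 ∧ p.2 ≤ b p.1}.indicator (Function.uncurry g) (a, s) := by
    intro a
    rw [← lintegral_indicator measurableSet_Icc]
    rfl
  simp only [this]
  exact (hg.indicator hs).lintegral_prod_right'

/-! ### The recursion for conditional distribution functions. -/

section ConditionalPair

variable {Ω E : Type*} [MeasurableSpace Ω] [MeasureSpace E] [SigmaFinite (volume : Measure E)]
  {P : Measure Ω} [IsProbabilityMeasure P] {Z : Ω → E} {Y W : Ω → ℝ}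
  (hZ : AEMeasurable Z P) (hY : AEMeasurable Y P) (hW : AEMeasurable W P)
  (hac : P.map (fun ω => (Z ω, (Y ω, W ω))) ≪ volume)
  {C : ℝ → ℝ → E → ℝ} {c : ℝ → ℝ → E → ℝ≥0∞}
  (hm : Measurable fun p : ℝ × ℝ × E => c p.1 p.2.1 p.2.2)
  (hC : ∀ᵐ z ∂P.map Z, IsCopulaOf (fun u v => C u v z)
    (condDistrib (fun ω => (Y ω, W ω)) Z P z))
  (hc : ∀ᵐ z ∂P.map Z, IsCopulaDensity (fun u v => c u v z) (fun u v => C u v z))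
include hZ hY hW hac hm hC hc

/-- Integrated over any measurable `A`, both sides give the probability that (Z, Y) ∈ A and W ≤ t:
the left by disintegrating over (Z, Y), the right by disintegrating over Z and inserting the copula
density of (Y, W). -/
theorem ae_condDistrib_Iic_eq_setLIntegral (t : ℝ) : ∀ᵐ p ∂P.map fun ω => (Z ω, Y ω),
    condDistrib W (fun ω => (Z ω, Y ω)) P p (Set.Iic t) =
      ∫⁻ s in Set.Icc 0 (cdf (condDistrib W Z P p.1) t),
        c (cdf (condDistrib Y Z P p.1) p.2) s p.1 := by
  have hG₁ := measurable_cdf_kernel (condDistrib Y Z P)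
  have hG₂ := measurable_cdf_kernel (condDistrib W Z P)
  have hg : Measurable fun p : (E × ℝ) × ℝ => c (cdf (condDistrib Y Z P p.1.1) p.1.2) p.2 p.1.1 :=
    hm.comp ((hG₁.comp measurable_fst).prodMk
      (measurable_snd.prodMk (measurable_fst.comp measurable_fst)))
  have hR : Measurable fun p : E × ℝ => ∫⁻ s in Set.Icc 0 (cdf (condDistrib W Z P p.1) t),
      c (cdf (condDistrib Y Z P p.1) p.2) s p.1 := by
    refine measurable_setLIntegral_Icc
      (g := fun (p : E × ℝ) s => c (cdf (condDistrib Y Z P p.1) p.2) s p.1)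
      (b := fun p => cdf (condDistrib W Z P p.1) t) hg ?_
    exact hG₂.comp (measurable_fst.prodMk measurable_const)
  have : IsProbabilityMeasure (P.map fun ω => (Z ω, Y ω)) :=
    Measure.isProbabilityMeasure_map (hZ.prodMk hY)
  have : IsProbabilityMeasure (P.map Z) := Measure.isProbabilityMeasure_map hZ
  have hL : Measurable fun p : E × ℝ => condDistrib W (fun ω => (Z ω, Y ω)) P p (Set.Iic t) :=
    Kernel.measurable_coe _ measurableSet_Iic
  suffices key : ∀ A : Set (E × ℝ), MeasurableSet A →
      ∫⁻ p in A, condDistrib W (fun ω => (Z ω, Y ω)) P p (Set.Iic t)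
          ∂(P.map fun ω => (Z ω, Y ω)) =
        ∫⁻ p in A, (∫⁻ s in Set.Icc 0 (cdf (condDistrib W Z P p.1) t),
          c (cdf (condDistrib Y Z P p.1) p.2) s p.1) ∂(P.map fun ω => (Z ω, Y ω)) from
    ae_eq_of_forall_setLIntegral_eq_of_sigmaFinite (μ := P.map fun ω => (Z ω, Y ω))
      (f := fun p => condDistrib W (fun ω => (Z ω, Y ω)) P p (Set.Iic t))
      (g := fun p => ∫⁻ s in Set.Icc 0 (cdf (condDistrib W Z P p.1) t),
        c (cdf (condDistrib Y Z P p.1) p.2) s p.1) hL hR fun A hA _ => key A hA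
  intro A hA
  have hAt : MeasurableSet {q : E × (ℝ × ℝ) | (q.1, q.2.1) ∈ A ∧ q.2.2 ≤ t} :=
    ((measurable_fst.prodMk (measurable_fst.comp measurable_snd)) hA).inter
      (measurableSet_le (measurable_snd.comp measurable_snd) measurable_const)
  calc ∫⁻ p in A, condDistrib W (fun ω => (Z ω, Y ω)) P p (Set.Iic t)
        ∂(P.map fun ω => (Z ω, Y ω))
      = ((P.map fun ω => (Z ω, Y ω)) ⊗ₘ condDistrib W (fun ω => (Z ω, Y ω)) P)
          (A ×ˢ Set.Iic t) :=
        (Measure.compProd_apply_prod hA measurableSet_Iic).symm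
    _ = P.map (fun ω => (Z ω, (Y ω, W ω))) {q | (q.1, q.2.1) ∈ A ∧ q.2.2 ≤ t} := by
        rw [compProd_map_condDistrib hW,
          Measure.map_apply_of_aemeasurable ((hZ.prodMk hY).prodMk hW) (hA.prod measurableSet_Iic),
          Measure.map_apply_of_aemeasurable (hZ.prodMk (hY.prodMk hW)) hAt]
        rfl
    _ = ∫⁻ z, condDistrib (fun ω => (Y ω, W ω)) Z P z
          (Prod.mk z ⁻¹' {q | (q.1, q.2.1) ∈ A ∧ q.2.2 ≤ t}) ∂P.map Z := by
        rw [← compProd_map_condDistrib (X := Z) (hY.prodMk hW),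
          Measure.compProd_apply hAt]
    _ = ∫⁻ z, ∫⁻ y in Prod.mk z ⁻¹' A, (∫⁻ s in Set.Icc 0 (cdf (condDistrib W Z P z) t),
          c (cdf (condDistrib Y Z P z) y) s z) ∂condDistrib Y Z P z ∂P.map Z := by
        refine lintegral_congr_ae ?_
        filter_upwards [ae_condDistrib_eq_withDensity_copulaDensity hZ hY hW hac hm hC hc,
          ae_nullSingletonClass_condDistrib_right hZ hY hW hac] with z hz n₂
        have hset : Prod.mk z ⁻¹' {q : E × (ℝ × ℝ) | (q.1, q.2.1) ∈ A ∧ q.2.2 ≤ t} =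
            (Prod.mk z ⁻¹' A) ×ˢ Set.Iic t := by
          ext q; simp
        have hcz : Measurable fun p : ℝ × ℝ =>
            c (cdf (condDistrib Y Z P z) p.1) (cdf (condDistrib W Z P z) p.2) z :=
          hm.comp ((hG₁.comp (measurable_const.prodMk measurable_fst)).prodMk
            ((hG₂.comp (measurable_const.prodMk measurable_snd)).prodMk measurable_const))
        rw [hset, hz, withDensity_apply _ ((measurable_prodMk_left hA).prod measurableSet_Iic),
          ← Measure.prod_restrict, lintegral_prod _ hcz.aemeasurable]
        refine lintegral_congr fun y => ?_
        exact setLIntegral_Iic_comp_cdf (condDistrib W Z P z)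
          (m := fun s => c (cdf (condDistrib Y Z P z) y) s z)
          (hm.comp (measurable_const.prodMk (measurable_id.prodMk measurable_const))) t
    _ = _ := by
        rw [← compProd_map_condDistrib (X := Z) hY, ← lintegral_indicator hA,
          Measure.lintegral_compProd (hR.indicator hA)]
        refine lintegral_congr fun z => ?_
        rw [← lintegral_indicator (measurable_prodMk_left hA)]
        rfl

/-- The recursion for conditional distribution functions: conditioning on one more variable is
differentiating the conditional copula. -/
theorem ae_hasDerivAt_condCopula : ∀ᵐ p ∂P.map fun ω => (Z ω, Y ω), ∀ t : ℝ,
    HasDerivAt (fun u => C u (cdf (condDistrib W Z P p.1) t) p.1)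
      (cdf (condDistrib W (fun ω => (Z ω, Y ω)) P p) t) (cdf (condDistrib Y Z P p.1) p.2) := by
  have hG₁ := measurable_cdf_kernel (condDistrib Y Z P)
  have hG₂ := measurable_cdf_kernel (condDistrib W Z P)
  have : IsProbabilityMeasure (P.map fun ω => (Z ω, Y ω)) :=
    Measure.isProbabilityMeasure_map (hZ.prodMk hY)
  have : IsProbabilityMeasure (P.map Z) := Measure.isProbabilityMeasure_map hZ
  have hfst : ∀ {p : E → Prop}, (∀ᵐ z ∂P.map Z, p z) →
      ∀ᵐ q ∂P.map fun ω => (Z ω, Y ω), p q.1 := by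
    intro p hp
    refine ae_of_ae_map (f := Prod.fst) measurable_fst.aemeasurable ?_
    rwa [show (P.map fun ω => (Z ω, Y ω)).map Prod.fst = P.map Z from Measure.fst_map_prodMk₀ hY]
  have hIoo : ∀ᵐ p ∂P.map fun ω => (Z ω, Y ω),
      cdf (condDistrib Y Z P p.1) p.2 ∈ Set.Ioo (0 : ℝ) 1 := by
    rw [← compProd_map_condDistrib hY]
    refine Measure.ae_compProd_of_ae_ae (hG₁ measurableSet_Ioo) ?_
    filter_upwards [ae_nullSingletonClass_condDistrib_left hZ hY hW hac] with z n₁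
    exact ae_cdf_mem_Ioo (condDistrib Y Z P z)
  have hWac : ∀ᵐ p ∂P.map fun ω => (Z ω, Y ω),
      NullSingletonClass (condDistrib W (fun ω => (Z ω, Y ω)) P p) := by
    have h : P.map (fun ω => ((Z ω, Y ω), W ω)) ≪ (volume : Measure ((E × ℝ) × ℝ)) :=
      map_comp_absolutelyContinuous (f := MeasurableEquiv.prodAssoc.symm)
        (hZ.prodMk (hY.prodMk hW)) hac
        (volume_preserving_prodAssoc.symm MeasurableEquiv.prodAssoc).quasiMeasurePreserving
    filter_upwards [ae_condDistrib_absolutelyContinuous hW h] with p hp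
    exact nullSingletonClass_of_absolutelyContinuous hp
  -- A jointly measurable substitute for `C`, whose dependence on `z` is not assumed measurable. For
  -- almost every `z` the two agree on the unit square.
  set Φ : E → ℝ → ℝ → ℝ := fun z u v =>
    (∫⁻ s in Set.Icc 0 u, ∫⁻ t in Set.Icc 0 v, c s t z).toReal with hΦ
  have hΦC : ∀ᵐ z ∂P.map Z, ∀ u ∈ Set.Icc (0 : ℝ) 1, ∀ v ∈ Set.Icc (0 : ℝ) 1,
      Φ z u v = C u v z := by
    filter_upwards [hC, hc] with z hCz hcz u hu v hv
    rw [hΦ]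
    dsimp only
    rw [← hcz u hu v hv, ENNReal.toReal_ofReal (hCz.1.nonneg hu hv)]
  -- For each fixed `z` the derivative exists for almost every `y`. Joining these fibrewise
  -- statements into one about (Z, Y) requires a measurable set, hence `Φ` and the rational test.
  have hrat : ∀ᵐ p ∂P.map fun ω => (Z ω, Y ω), ∀ q : ℚ,
      HasRatDerivAt (fun u => Φ p.1 u (cdf (condDistrib W Z P p.1) q))
        (∫⁻ s in Set.Icc 0 (cdf (condDistrib W Z P p.1) q),
          c (cdf (condDistrib Y Z P p.1) p.2) s p.1).toReal
        (cdf (condDistrib Y Z P p.1) p.2) := by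
    rw [ae_all_iff]
    intro q
    rw [← compProd_map_condDistrib hY]
    refine Measure.ae_compProd_of_ae_ae ?_ ?_
    · refine measurableSet_hasRatDerivAt (L := fun p : E × ℝ =>
        (∫⁻ s in Set.Icc 0 (cdf (condDistrib W Z P p.1) q),
          c (cdf (condDistrib Y Z P p.1) p.2) s p.1).toReal)
        (φ := fun p : E × ℝ => fun u => Φ p.1 u (cdf (condDistrib W Z P p.1) q))
        (G := fun p : E × ℝ => cdf (condDistrib Y Z P p.1) p.2) ?_ ?_ hG₁
      · refine Measurable.ennreal_toReal (f := fun x : (E × ℝ) × ℝ => ∫⁻ s in Set.Icc 0 x.2,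
          ∫⁻ t in Set.Icc 0 (cdf (condDistrib W Z P x.1.1) q), c s t x.1.1) ?_
        refine measurable_setLIntegral_Icc (g := fun (x : (E × ℝ) × ℝ) s =>
          ∫⁻ t in Set.Icc 0 (cdf (condDistrib W Z P x.1.1) q), c s t x.1.1) ?_ measurable_snd
        refine measurable_setLIntegral_Icc
          (g := fun (x : ((E × ℝ) × ℝ) × ℝ) t => c x.2 t x.1.1.1)
          (b := fun x => cdf (condDistrib W Z P x.1.1.1) q) ?_ ?_
        · exact hm.comp ((measurable_snd.comp measurable_fst).prodMk (measurable_snd.prodMk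
            (measurable_fst.comp (measurable_fst.comp (measurable_fst.comp measurable_fst)))))
        · exact hG₂.comp ((measurable_fst.comp (measurable_fst.comp measurable_fst)).prodMk
            measurable_const)
      · refine Measurable.ennreal_toReal (measurable_setLIntegral_Icc
          (g := fun (p : E × ℝ) s => c (cdf (condDistrib Y Z P p.1) p.2) s p.1)
          (b := fun p => cdf (condDistrib W Z P p.1) q) ?_ ?_)
        · exact hm.comp ((hG₁.comp measurable_fst).prodMk
            (measurable_snd.prodMk (measurable_fst.comp measurable_fst)))
        · exact hG₂.comp (measurable_fst.prodMk measurable_const)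
    · filter_upwards [ae_nullSingletonClass_condDistrib_left hZ hY hW hac,
        ae_nullSingletonClass_condDistrib_right hZ hY hW hac, hC, hc, hΦC]
        with z n₁ n₂ hCz hcz hΦz
      have hmz : Measurable (Function.uncurry fun u v => c u v z) :=
        hm.comp (measurable_fst.prodMk (measurable_snd.prodMk measurable_const))
      filter_upwards [ae_hasDerivAt_copula (ν₁ := condDistrib Y Z P z)
        (ν₂ := condDistrib W Z P z) hCz.1 hcz hmz q, ae_cdf_mem_Ioo (condDistrib Y Z P z)]
        with y hy hyI
      have hcd := setLIntegral_Iic_comp_cdf (condDistrib W Z P z)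
        (m := fun s => c (cdf (condDistrib Y Z P z) y) s z) hmz.of_uncurry_left q
      rw [hcd] at hy
      refine (hy.congr_of_eventuallyEq ?_).hasRatDerivAt
      filter_upwards [Ioo_mem_nhds hyI.1 hyI.2] with u hu
      exact hΦz u (Set.Ioo_subset_Icc_self hu) _ (cdf_mem_Icc _ _)
  have hcdf : ∀ᵐ p ∂P.map fun ω => (Z ω, Y ω), ∀ q : ℚ,
      condDistrib W (fun ω => (Z ω, Y ω)) P p (Set.Iic (q : ℝ)) =
        ∫⁻ s in Set.Icc 0 (cdf (condDistrib W Z P p.1) q),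
          c (cdf (condDistrib Y Z P p.1) p.2) s p.1 :=
    ae_all_iff.2 fun q => ae_condDistrib_Iic_eq_setLIntegral hZ hY hW hac hm hC hc q
  filter_upwards [hrat, hcdf, hIoo, hWac, hfst hΦC, hfst hC] with p hrat hcdf hI n hΦp hCp
  intro t
  refine hasDerivAt_of_forall_rat (φ := fun t u => C u (cdf (condDistrib W Z P p.1) t) p.1)
    (L := cdf (condDistrib W (fun ω => (Z ω, Y ω)) P p)) hI (fun q => ?_) (fun s s' hs => ?_)
    (continuous_cdf _).continuousAt
  · have h1 := hrat q
    rw [← hcdf q, ← measureReal_def, ← cdf_eq_real] at h1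
    have hnhds : Set.Ioo (0 : ℝ) 1 ∈ nhds (cdf (condDistrib Y Z P p.1) p.2) :=
      Ioo_mem_nhds hI.1 hI.2
    have heq : Set.EqOn (fun u => Φ p.1 u (cdf (condDistrib W Z P p.1) q))
        (fun u => C u (cdf (condDistrib W Z P p.1) q) p.1) (Set.Icc 0 1) :=
      fun u hu => hΦp u hu _ (cdf_mem_Icc _ _)
    -- Continuity of the copula in its first argument recovers the true derivative from the rational
    -- test.
    refine (h1.hasDerivAt (s := Set.Icc 0 1)
      (Filter.mem_of_superset hnhds Set.Ioo_subset_Icc_self)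
      ((hCp.1.continuousOn_left (cdf_mem_Icc _ _)).congr heq)).congr_of_eventuallyEq ?_
    filter_upwards [hnhds] with u hu
    exact (heq (Set.Ioo_subset_Icc_self hu)).symm
  · exact hCp.1.monotoneOn_sub (cdf_mem_Icc _ _) (cdf_mem_Icc _ _) (monotone_cdf _ hs)

end ConditionalPair

/-! ### Change of coordinates in conditional laws and densities. -/

theorem ae_condDistrib_comp_embedding {Ω α β γ : Type*} [MeasurableSpace Ω] [MeasurableSpace α]
    [MeasurableSpace β] [MeasurableSpace γ] [StandardBorelSpace γ] [Nonempty γ] {P : Measure Ω}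
    [IsFiniteMeasure P] {V : Ω → α} {W : Ω → γ} {g : α → β} (hg : MeasurableEmbedding g)
    (hV : AEMeasurable V P) (hW : AEMeasurable W P) :
    ∀ᵐ a ∂P.map V, condDistrib W V P a = condDistrib W (fun ω => g (V ω)) P (g a) := by
  set κ := condDistrib W (fun ω => g (V ω)) P with hκ
  have hgV : AEMeasurable (fun ω => g (V ω)) P := hg.measurable.comp_aemeasurable hV
  -- By uniqueness of disintegrations it suffices that the pulled-back kernel reproduces the joint
  -- law. This is checked on images under `g`, whose sections over `g a` are the original sections
  -- over `a`.
  refine condDistrib_ae_eq_of_measure_eq_compProd V hW (κ := κ.comap g hg.measurable) ?_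
  ext s hs
  have hinj : Function.Injective (Prod.map g (id : γ → γ)) := hg.injective.prodMap fun _ _ h => h
  have hs' : MeasurableSet (Prod.map g (id : γ → γ) '' s) :=
    (hg.prodMap MeasurableEmbedding.id).measurableSet_image.2 hs
  have hsec : ∀ a, Prod.mk (g a) ⁻¹' (Prod.map g (id : γ → γ) '' s) = Prod.mk a ⁻¹' s := by
    intro a
    ext x
    exact hinj.mem_set_image (a := (a, x))
  rw [Measure.compProd_apply hs]
  simp only [Kernel.comap_apply, ← hsec]
  rw [← hg.lintegral_map (f := fun b => κ b (Prod.mk b ⁻¹' (Prod.map g (id : γ → γ) '' s))),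
    AEMeasurable.map_map_of_aemeasurable hg.measurable.aemeasurable hV]
  change _ = ∫⁻ b, _ ∂P.map fun ω => g (V ω)
  rw [← Measure.compProd_apply hs', hκ, compProd_map_condDistrib hW,
    Measure.map_apply_of_aemeasurable (hgV.prodMk hW) hs',
    Measure.map_apply_of_aemeasurable (hV.prodMk hW) hs]
  congr 1
  ext ω
  exact (hinj.mem_set_image (a := (V ω, W ω))).symm

theorem ae_pdf_comp_embedding {Ω α β : Type*} [MeasurableSpace Ω] [MeasureSpace α]
    [MeasureSpace β] [SigmaFinite (volume : Measure α)] {P : Measure Ω} [IsProbabilityMeasure P]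
    {V : Ω → α} {g : α → β} (hg : MeasurableEmbedding g)
    (hgv : MeasurePreserving g volume volume) (hV : AEMeasurable V P) :
    ∀ᵐ a : α, pdf (fun ω => g (V ω)) P volume (g a) = pdf V P volume a := by
  have : IsProbabilityMeasure (P.map V) := Measure.isProbabilityMeasure_map hV
  have h := hg.rnDeriv_map (P.map V) volume
  rw [hgv.map_eq, AEMeasurable.map_map_of_aemeasurable hg.measurable.aemeasurable hV] at h
  exact h

section Coordinates

variable {ι : Type*} [DecidableEq ι] {S T : Finset ι} {a b : ι}

/-- Splitting a vector indexed by `S ∪ {a}` into its restriction to `S` and its `a`-th entry. -/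
def splitOne (hS : S ⊆ T) (ha : a ∈ T) (z : T → ℝ) : (S → ℝ) × ℝ :=
  (Finset.restrict₂ (π := fun _ => ℝ) hS z, z ⟨a, ha⟩)

omit [DecidableEq ι] in
theorem measurable_splitOne (hS : S ⊆ T) (ha : a ∈ T) : Measurable (splitOne hS ha) :=
  (measurable_pi_lambda _ fun i : S => measurable_pi_apply (⟨i, hS i.2⟩ : T)).prodMk
    (measurable_pi_apply (⟨a, ha⟩ : T))

theorem measurableEmbedding_splitOne (hS : S ⊆ T) (ha : a ∈ T) (hT : T = S ∪ {a}) :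
    MeasurableEmbedding (splitOne hS ha) := by
  refine (measurable_splitOne hS ha).measurableEmbedding fun z w h => funext fun i => ?_
  have h1 := congrArg Prod.fst h
  have h2 : z ⟨a, ha⟩ = w ⟨a, ha⟩ := congrArg Prod.snd h
  obtain ⟨i, hi⟩ := i
  have hi' := hi
  rw [hT, Finset.mem_union, Finset.mem_singleton] at hi'
  rcases hi' with hi' | rfl
  · exact congrFun h1 ⟨i, hi'⟩
  · exact h2

theorem measurePreserving_splitOne (hS : S ⊆ T) (ha : a ∈ T) (hT : T = S ∪ {a}) (haS : a ∉ S) :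
    MeasurePreserving (splitOne hS ha) volume volume := by
  subst hT
  have hdisj : Disjoint S {a} := Finset.disjoint_singleton_right.2 haS
  have he := volume_preserving_piFinsetUnion (fun _ : ι => ℝ) hdisj
  refine ⟨measurable_splitOne hS ha, ?_⟩
  rw [← he.map_eq, Measure.map_map (measurable_splitOne hS ha) he.measurable]
  have hcomp : splitOne hS ha ∘ MeasurableEquiv.piFinsetUnion (fun _ : ι => ℝ) hdisj =
      Prod.map id (MeasurableEquiv.funUnique ({a} : Finset ι) ℝ) := by
    funext p
    refine Prod.ext (funext fun i => ?_) ?_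
    · exact Equiv.piFinsetUnion_left (fun _ : ι => ℝ) hdisj i.2 _
    · exact Equiv.piFinsetUnion_right (fun _ : ι => ℝ) hdisj (Finset.mem_singleton_self a) _
  rw [hcomp]
  exact ((MeasurePreserving.id volume).prod
    (volume_preserving_funUnique ({a} : Finset ι) ℝ)).map_eq

/-- Splitting a vector indexed by `S ∪ {a, b}` into its restriction to `S` and two entries. -/
def splitTwo (hS : S ⊆ T) (ha : a ∈ T) (hb : b ∈ T) (z : T → ℝ) : (S → ℝ) × (ℝ × ℝ) :=
  (Finset.restrict₂ (π := fun _ => ℝ) hS z, (z ⟨a, ha⟩, z ⟨b, hb⟩))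

theorem measurableEmbedding_splitTwo (hS : S ⊆ T) (ha : a ∈ T) (hb : b ∈ T)
    (hT : T = S ∪ {a} ∪ {b}) : MeasurableEmbedding (splitTwo hS ha hb) := by
  have hm : Measurable (splitTwo hS ha hb) :=
    (measurable_pi_lambda _ fun i : S => measurable_pi_apply (⟨i, hS i.2⟩ : T)).prodMk
    ((measurable_pi_apply (⟨a, ha⟩ : T)).prodMk (measurable_pi_apply (⟨b, hb⟩ : T)))
  refine hm.measurableEmbedding fun z w h => funext fun i => ?_
  have h1 := congrArg Prod.fst h
  have h2 : z ⟨a, ha⟩ = w ⟨a, ha⟩ := congrArg (fun p => p.2.1) h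
  have h3 : z ⟨b, hb⟩ = w ⟨b, hb⟩ := congrArg (fun p => p.2.2) h
  obtain ⟨i, hi⟩ := i
  have hi' := hi
  rw [hT, Finset.mem_union, Finset.mem_union, Finset.mem_singleton, Finset.mem_singleton] at hi'
  rcases hi' with (hi' | rfl) | rfl
  · exact congrFun h1 ⟨i, hi'⟩
  · exact h2
  · exact h3

theorem measurePreserving_splitTwo (hS : S ⊆ T) (ha : a ∈ T) (hb : b ∈ T)
    (hT : T = S ∪ {a} ∪ {b}) (haS : a ∉ S) (hbS : b ∉ S) (hab : a ≠ b) :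
    MeasurePreserving (splitTwo hS ha hb) volume volume := by
  have hU : S ∪ {a} ⊆ T := hT ▸ Finset.subset_union_left
  have h1 := measurePreserving_splitOne hU hb hT (by simp [hbS, hab.symm])
  have h2 := measurePreserving_splitOne (S := S) (T := S ∪ {a}) (a := a) Finset.subset_union_left
    (by simp) rfl haS
  exact volume_preserving_prodAssoc.comp ((h2.prod (MeasurePreserving.id volume)).comp h1)

theorem quasiMeasurePreserving_restrict [Fintype ι] (D : Finset ι) :
    Measure.QuasiMeasurePreserving (D.restrict : (ι → ℝ) → D → ℝ) volume volume := by
  have h := Measure.quasiMeasurePreserving_fst.comp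
    (volume_preserving_piEquivPiSubtypeProd (fun _ : ι => ℝ) (· ∈ D)).quasiMeasurePreserving
  -- The volume on `D → ℝ` depends on the choice of finiteness instance, and the two in play must be
  -- identified.
  rw [Subsingleton.elim (Subtype.fintype (· ∈ D)) (Finset.Subtype.fintype D)] at h
  exact h

end Coordinates

/-! ### Marginal densities of the random vector. -/

section RandomVector

variable {d : ℕ} {Ω : Type*} [MeasurableSpace Ω]

/-- The marginal density of the subvector `X_D`, as a function of the full vector `x`. -/
noncomputable def marginalPDF (P : Measure Ω) (X : Ω → Fin d → ℝ) (D : Finset (Fin d))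
    (x : Fin d → ℝ) : ℝ≥0∞ :=
  pdf (fun ω => D.restrict (X ω)) P volume (D.restrict x)

variable {P : Measure Ω} [IsProbabilityMeasure P] {X : Ω → Fin d → ℝ}

section Measurability

variable (hX : AEMeasurable X P)
include hX

omit [IsProbabilityMeasure P] in
theorem aemeasurable_coord (i : Fin d) : AEMeasurable (fun ω => X ω i) P :=
  (measurable_pi_apply i).comp_aemeasurable hX

omit [IsProbabilityMeasure P] in
theorem aemeasurable_restrict (D : Finset (Fin d)) :
    AEMeasurable (fun ω => D.restrict (X ω)) P :=
  (Finset.measurable_restrict D).comp_aemeasurable hX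

/-- The conditioning variable lives in a one-point space, so averaging the conditional law over it
is evaluation at that point. -/
theorem condDF_empty (j : Fin d) (t : ℝ) (z : (∅ : Finset (Fin d)) → ℝ) :
    condDF P X j ∅ t z = cdf (P.map fun ω => X ω j) t := by
  have h := condDistrib_comp_map (aemeasurable_restrict hX ∅) (aemeasurable_coord hX j)
  have hconst : (fun ω => Finset.restrict ∅ (X ω)) = fun _ : Ω => z :=
    funext fun ω => Subsingleton.elim _ _
  rw [hconst, Measure.map_const, measure_univ, one_smul,
    Measure.dirac_bind (Kernel.measurable _)] at h
  rw [condDF, hconst, h]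

omit hX in
theorem marginalPDF_empty (x : Fin d → ℝ) : marginalPDF P X ∅ x = 1 := by
  have hconst : (fun ω => Finset.restrict ∅ (X ω)) = fun _ : Ω => Finset.restrict ∅ x :=
    funext fun ω => Subsingleton.elim _ _
  have hvol : (volume : Measure ((∅ : Finset (Fin d)) → ℝ)) =
      Measure.dirac (Finset.restrict ∅ x) := Measure.volume_pi_eq_dirac _
  have h1 : P.map (fun ω => Finset.restrict ∅ (X ω)) = volume := by
    rw [hconst, Measure.map_const, measure_univ, one_smul, hvol]
  have h2 := Measure.rnDeriv_self (volume : Measure ((∅ : Finset (Fin d)) → ℝ))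
  rw [marginalPDF, pdf_def, h1]
  rw [hvol] at h2 ⊢
  exact (ae_dirac_iff (measurableSet_eq_fun (Measure.measurable_rnDeriv _ _)
    measurable_one)).1 h2

end Measurability

variable (hX : HasPDF X P volume)
include hX

omit [IsProbabilityMeasure P] in
theorem map_splitTwo_absolutelyContinuous {S : Finset (Fin d)} {a b : Fin d} (haS : a ∉ S)
    (hbS : b ∉ S) (hab : a ≠ b) :
    P.map (fun ω => (S.restrict (X ω), (X ω a, X ω b))) ≪ volume :=
  map_comp_absolutelyContinuous hX.aemeasurable hX.absolutelyContinuous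
    ((measurePreserving_splitTwo (S := S) (T := S ∪ {a} ∪ {b}) (a := a) (b := b)
      (Finset.subset_union_left.trans Finset.subset_union_left) (by simp) (by simp) rfl
      haS hbS hab).quasiMeasurePreserving.comp (quasiMeasurePreserving_restrict _))

theorem ae_marginalPDF_union_singleton {S : Finset (Fin d)} {a : Fin d} (haS : a ∉ S) :
    ∀ᵐ x : Fin d → ℝ, pdf (fun ω => (S.restrict (X ω), X ω a)) P volume (S.restrict x, x a) =
      marginalPDF P X (S ∪ {a}) x :=
  (quasiMeasurePreserving_restrict _).ae (ae_pdf_comp_embedding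
    (measurableEmbedding_splitOne (S := S) (T := S ∪ {a}) (a := a)
      Finset.subset_union_left (by simp) rfl)
    (measurePreserving_splitOne _ _ rfl haS)
    (aemeasurable_restrict hX.aemeasurable (S ∪ {a})))

theorem ae_marginalPDF_union_pair {S : Finset (Fin d)} {a b : Fin d} (haS : a ∉ S)
    (hbS : b ∉ S) (hab : a ≠ b) : ∀ᵐ x : Fin d → ℝ,
    pdf (fun ω => (S.restrict (X ω), (X ω a, X ω b))) P volume (S.restrict x, (x a, x b)) =
      marginalPDF P X (S ∪ {a} ∪ {b}) x :=
  (quasiMeasurePreserving_restrict _).ae (ae_pdf_comp_embedding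
    (measurableEmbedding_splitTwo (S := S) (T := S ∪ {a} ∪ {b}) (a := a) (b := b)
      (Finset.subset_union_left.trans Finset.subset_union_left) (by simp) (by simp) rfl)
    (measurePreserving_splitTwo _ _ _ rfl haS hbS hab)
    (aemeasurable_restrict hX.aemeasurable (S ∪ {a} ∪ {b})))

theorem ae_marginalPDF_singleton : ∀ᵐ x : Fin d → ℝ, ∀ i,
    marginalPDF P X {i} x = pdf (fun ω => X ω i) P volume (x i) := by
  rw [ae_all_iff]
  intro i
  have h := ae_pdf_comp_embedding
    (MeasurableEquiv.funUnique ({i} : Finset (Fin d)) ℝ).measurableEmbedding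
    (volume_preserving_funUnique ({i} : Finset (Fin d)) ℝ)
    (aemeasurable_restrict hX.aemeasurable {i})
  filter_upwards [(quasiMeasurePreserving_restrict ({i} : Finset (Fin d))).ae h] with x hx
  exact hx.symm

theorem ae_marginalPDF_univ : ∀ᵐ x : Fin d → ℝ, marginalPDF P X Finset.univ x =
    pdf X P volume x := by
  have hmp := volume_preserving_arrowCongr'
    (Equiv.subtypeUnivEquiv (fun i : Fin d => Finset.mem_univ i)).symm (MeasurableEquiv.refl ℝ)
    (MeasurePreserving.id volume)
  have h := ae_pdf_comp_embedding (MeasurableEquiv.measurableEmbedding _) hmp hX.aemeasurable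
  exact h

theorem ae_marginalPDF_ne_top : ∀ᵐ x : Fin d → ℝ, ∀ D, marginalPDF P X D x ≠ ∞ := by
  rw [ae_all_iff]
  intro D
  have : IsProbabilityMeasure (P.map fun ω => D.restrict (X ω)) :=
    Measure.isProbabilityMeasure_map (aemeasurable_restrict hX.aemeasurable D)
  have h : ∀ᵐ z : D → ℝ, pdf (fun ω => D.restrict (X ω)) P volume z ≠ ∞ :=
    Measure.rnDeriv_ne_top _ _
  exact (quasiMeasurePreserving_restrict D).ae h

/-- A density is almost surely nonzero under its own law, so all marginal densities are nonzero
almost everywhere for the law of `X`. That law has density `pdf X P volume`, which turns this into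
the stated Lebesgue-a.e. implication. -/
theorem ae_marginalPDF_ne_zero : ∀ᵐ x : Fin d → ℝ, pdf X P volume x ≠ 0 →
    ∀ D, marginalPDF P X D x ≠ 0 := by
  have hall : ∀ᵐ x ∂P.map X, ∀ D, marginalPDF P X D x ≠ 0 := by
    rw [ae_all_iff]
    intro D
    have hXD := aemeasurable_restrict hX.aemeasurable D
    have hac : P.map (fun ω => D.restrict (X ω)) ≪ volume :=
      map_comp_absolutelyContinuous hX.aemeasurable hX.absolutelyContinuous
        (quasiMeasurePreserving_restrict D)
    have : IsProbabilityMeasure (P.map fun ω => D.restrict (X ω)) :=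
      Measure.isProbabilityMeasure_map hXD
    have h : ∀ᵐ z ∂P.map fun ω => D.restrict (X ω),
        pdf (fun ω => D.restrict (X ω)) P volume z ≠ 0 := by
      filter_upwards [Measure.rnDeriv_pos hac] with z hz using hz.ne'
    have heq : (P.map fun ω => D.restrict (X ω)) = (P.map X).map D.restrict :=
      (AEMeasurable.map_map_of_aemeasurable (Finset.measurable_restrict D).aemeasurable
        hX.aemeasurable).symm
    rw [heq] at h
    exact ae_of_ae_map (Finset.measurable_restrict D).aemeasurable h
  have hd := map_eq_withDensity_pdf X P volume
  rw [hd] at hall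
  exact (ae_withDensity_iff (measurable_pdf X P volume)).1 hall

/-- Jointly measurable conditional copula densities exist for all pairs and conditioning sets. -/
theorem exists_isPairCopulaFamily : ∃ C c, IsPairCopulaFamily P X C c := by
  have key : ∀ (i j : Fin d) (D : Finset (Fin d)), ∃ (C : ℝ → ℝ → (D → ℝ) → ℝ)
      (c : ℝ → ℝ → (D → ℝ) → ℝ≥0∞), i ≠ j → i ∉ D → j ∉ D →
      (Measurable fun p : ℝ × ℝ × (D → ℝ) => c p.1 p.2.1 p.2.2) ∧
      IsCondCopula P X i j D C ∧
      ∀ᵐ z ∂(P.map fun ω => D.restrict (X ω)),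
        IsCopulaDensity (fun u v => c u v z) (fun u v => C u v z) := by
    intro i j D
    by_cases h : i ≠ j ∧ i ∉ D ∧ j ∉ D
    · obtain ⟨C, c, h1, h2, h3⟩ := exists_condCopula (aemeasurable_restrict hX.aemeasurable D)
        (aemeasurable_coord hX.aemeasurable i) (aemeasurable_coord hX.aemeasurable j)
        (map_splitTwo_absolutelyContinuous hX h.2.1 h.2.2 h.1)
      exact ⟨C, c, fun _ _ _ => ⟨h1, h2, h3⟩⟩
    · exact ⟨0, 0, fun h1 h2 h3 => absurd ⟨h1, h2, h3⟩ h⟩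
  choose C c hCc using key
  exact ⟨C, c, fun i j D h1 h2 h3 => (hCc i j D h1 h2 h3).2.1,
    fun i j D h1 h2 h3 => (hCc i j D h1 h2 h3).1, fun i j D h1 h2 h3 => (hCc i j D h1 h2 h3).2.2⟩

variable {C : Fin d → Fin d → (D : Finset (Fin d)) → ℝ → ℝ → (D → ℝ) → ℝ}
  {c : Fin d → Fin d → (D : Finset (Fin d)) → ℝ → ℝ → (D → ℝ) → ℝ≥0∞}
  (hCc : IsPairCopulaFamily P X C c)
include hCc

theorem ae_marginalPDF_mul_eq : ∀ᵐ x : Fin d → ℝ, ∀ (a b : Fin d) (S : Finset (Fin d)),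
    a ≠ b → a ∉ S → b ∉ S →
    marginalPDF P X (S ∪ {a} ∪ {b}) x * marginalPDF P X S x =
      marginalPDF P X (S ∪ {a}) x * marginalPDF P X (S ∪ {b}) x *
        c a b S (condDF P X a S (x a) (S.restrict x)) (condDF P X b S (x b) (S.restrict x))
          (S.restrict x) := by
  simp only [ae_all_iff]
  intro a b S hab haS hbS
  have h := ae_pdf_mul_pdf_eq (aemeasurable_restrict hX.aemeasurable S)
    (aemeasurable_coord hX.aemeasurable a) (aemeasurable_coord hX.aemeasurable b)
    (map_splitTwo_absolutelyContinuous hX haS hbS hab)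
    (hCc.measurable_density a b S hab haS hbS) (hCc.isCondCopula a b S hab haS hbS)
    (hCc.isDensity a b S hab haS hbS)
  have hq : Measure.QuasiMeasurePreserving (fun x : Fin d → ℝ => (S.restrict x, (x a, x b)))
      volume volume :=
    ((measurePreserving_splitTwo (S := S) (T := S ∪ {a} ∪ {b}) (a := a) (b := b)
      (Finset.subset_union_left.trans Finset.subset_union_left) (by simp) (by simp) rfl
      haS hbS hab).quasiMeasurePreserving.comp (quasiMeasurePreserving_restrict _))
  filter_upwards [hq.ae h, ae_marginalPDF_union_pair hX haS hbS hab,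
    ae_marginalPDF_union_singleton hX haS, ae_marginalPDF_union_singleton hX hbS]
    with x h h1 h2 h3
  rw [← h1, ← h2, ← h3]
  exact h

theorem ae_hasDerivAt_pairCopula (D : Finset (Fin d)) (i : Fin d) (hi : i ∈ D) (j : Fin d)
    (hj : j ∉ D) : ∀ᵐ z : D → ℝ ∂(P.map fun ω => D.restrict (X ω)), ∀ t : ℝ,
      HasDerivAt
        (fun u => C i j (D.erase i) u
          (condDF P X j (D.erase i) t
            (Finset.restrict₂ (π := fun _ => ℝ) (Finset.erase_subset i D) z))
          (Finset.restrict₂ (π := fun _ => ℝ) (Finset.erase_subset i D) z))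
        (condDF P X j D t z)
        (condDF P X i (D.erase i) (z ⟨i, hi⟩)
          (Finset.restrict₂ (π := fun _ => ℝ) (Finset.erase_subset i D) z)) := by
  have hij : i ≠ j := fun h => hj (h ▸ hi)
  have hiS : i ∉ D.erase i := Finset.notMem_erase i D
  have hjS : j ∉ D.erase i := fun h => hj (Finset.mem_of_mem_erase h)
  have hD : D = D.erase i ∪ {i} := by
    rw [Finset.union_comm, ← Finset.insert_eq, Finset.insert_erase hi]
  have hXD := aemeasurable_restrict hX.aemeasurable D
  have hemb := measurableEmbedding_splitOne (Finset.erase_subset i D) hi hD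
  have h := ae_hasDerivAt_condCopula (aemeasurable_restrict hX.aemeasurable (D.erase i))
    (aemeasurable_coord hX.aemeasurable i) (aemeasurable_coord hX.aemeasurable j)
    (map_splitTwo_absolutelyContinuous hX hiS hjS hij)
    (hCc.measurable_density i j _ hij hiS hjS) (hCc.isCondCopula i j _ hij hiS hjS)
    (hCc.isDensity i j _ hij hiS hjS)
  -- Conditioning on X_D and conditioning on the pair (X_{D∖i}, X_i) differ only by the measurable
  -- embedding `splitOne`.
  have hmap : (P.map fun ω => ((D.erase i).restrict (X ω), X ω i)) =
      (P.map fun ω => D.restrict (X ω)).map (splitOne (Finset.erase_subset i D) hi) :=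
    (AEMeasurable.map_map_of_aemeasurable hemb.measurable.aemeasurable hXD).symm
  rw [hmap] at h
  filter_upwards [ae_of_ae_map hemb.measurable.aemeasurable h,
    ae_condDistrib_comp_embedding hemb hXD (aemeasurable_coord hX.aemeasurable j)]
    with z hz hcond t
  have hdf : condDF P X j D t z = cdf (condDistrib (fun ω => X ω j)
      (fun ω => splitOne (Finset.erase_subset i D) hi (D.restrict (X ω))) P
        (splitOne (Finset.erase_subset i D) hi z)) t := by
    rw [condDF, hcond]
  rw [hdf]
  exact hz t

end RandomVector

/-! ### Counting clusters and separators of consecutive cherry trees. -/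

section CherryTrees

/-- A tree with clusters `cl A` of size `k` attached injectively to its nodes, separators of size
`k - 1` and the running intersection property. Unlike for a `JunctionTree`, separators may be
empty, so that an ordinary tree with its vertices as clusters is included. -/
structure IsCherryLevel {V ι : Type*} [DecidableEq V] (G : SimpleGraph ι) (cl : ι → Finset V)
    (k : ℕ) : Prop where
  isTree : G.IsTree
  injective : Function.Injective cl
  card_cluster : ∀ A, (cl A).card = k
  card_separator : ∀ A B, G.Adj A B → (cl A ∩ cl B).card + 1 = k
  running_intersection : ∀ A B (p : G.Walk A B), p.IsPath → ∀ K ∈ p.support, cl A ∩ cl B ⊆ cl K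

open Classical in
/-- The ordered pairs of adjacent vertices of a graph. -/
noncomputable def adjPairs {ι : Type*} [Fintype ι] (G : SimpleGraph ι) : Finset (ι × ι) :=
  Finset.univ.filter fun p => G.Adj p.1 p.2

theorem mem_adjPairs {ι : Type*} [Fintype ι] {G : SimpleGraph ι} {p : ι × ι} :
    p ∈ adjPairs G ↔ G.Adj p.1 p.2 := by simp [adjPairs]

theorem sum_adjPairs_fst {ι : Type*} [Fintype ι] (G : SimpleGraph ι) [DecidableRel G.Adj]
    (ψ : ι → ℝ) : ∑ p ∈ adjPairs G, ψ p.1 = ∑ a, G.degree a * ψ a := by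
  classical
  rw [adjPairs, Finset.sum_filter, ← Finset.univ_product_univ, Finset.sum_product]
  refine Finset.sum_congr rfl fun a _ => ?_
  rw [← SimpleGraph.card_neighborFinset_eq_degree, ← nsmul_eq_mul, ← Finset.sum_const,
    SimpleGraph.neighborFinset_eq_filter, Finset.sum_filter]
  congr!

theorem sum_adjPairs_swap {ι : Type*} [Fintype ι] (G : SimpleGraph ι) (ψ : ι → ι → ℝ) :
    ∑ p ∈ adjPairs G, ψ p.2 p.1 = ∑ p ∈ adjPairs G, ψ p.1 p.2 :=
  Finset.sum_nbij' Prod.swap Prod.swap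
    (fun _ hp => mem_adjPairs.2 (mem_adjPairs.1 hp).symm)
    (fun _ hp => mem_adjPairs.2 (mem_adjPairs.1 hp).symm) (fun _ _ => rfl) (fun _ _ => rfl)
    (fun _ _ => rfl)

theorem card_adjPairs {ι : Type*} [Fintype ι] {G : SimpleGraph ι} (hG : G.IsTree) :
    (adjPairs G).card + 2 = 2 * Fintype.card ι := by
  classical
  have h1 := G.sum_degrees_eq_twice_card_edges
  have h2 := hG.card_edgeFinset
  have h3 := sum_adjPairs_fst G fun _ => 1
  simp only [Finset.sum_const, nsmul_eq_mul, mul_one] at h3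
  have h4 : (adjPairs G).card = ∑ a, G.degree a := by exact_mod_cast h3
  omega

theorem card_adjPairs_filter {ι : Type*} [Fintype ι] {G : SimpleGraph ι} (q : ι → Prop)
    [DecidablePred q] (hq : (G.induce {a | q a}).IsTree) :
    ((adjPairs G).filter fun p => q p.1 ∧ q p.2).card + 2 =
      2 * (Finset.univ.filter q).card := by
  have h := card_adjPairs hq
  rw [show Fintype.card {a | q a} = (Finset.univ.filter q).card from Fintype.card_subtype q] at h
  rw [← h]
  congr 1
  refine Finset.card_bij' (fun p hp => (⟨p.1, (Finset.mem_filter.1 hp).2.1⟩,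
    ⟨p.2, (Finset.mem_filter.1 hp).2.2⟩)) (fun p _ => (p.1.1, p.2.1)) ?_ ?_ ?_ ?_
  · intro p hp
    have h := mem_adjPairs.1 (Finset.mem_filter.1 hp).1
    exact mem_adjPairs.2 h
  · intro p hp
    have h := mem_adjPairs.1 hp
    exact Finset.mem_filter.2 ⟨mem_adjPairs.2 h, p.1.2, p.2.2⟩
  · intro p hp; rfl
  · intro p hp; rfl

variable {V ι κ : Type*} [DecidableEq V] {G : SimpleGraph ι} {cl : ι → Finset V} {k : ℕ}

theorem IsCherryLevel.eq_of_subset (hG : IsCherryLevel G cl k) {A B : ι} (h : cl A ⊆ cl B) :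
    A = B :=
  hG.injective (Finset.eq_of_subset_of_card_le h (by rw [hG.card_cluster, hG.card_cluster]))

/-- A cluster contained in the union of two linked clusters is one of them. -/
theorem IsCherryLevel.eq_or_eq_of_subset_union (hG : IsCherryLevel G cl k) {A B B' : ι}
    (hadj : G.Adj B B') (h : cl A ⊆ cl B ∪ cl B') : A = B ∨ A = B' := by
  classical
  obtain ⟨p, hp⟩ := hG.isTree.connected.exists_isPath A B
  by_cases hB' : B' ∈ p.support
  · right
    refine hG.eq_of_subset fun x hx => ?_
    rcases Finset.mem_union.1 (h hx) with hxB | hxB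
    · exact hG.running_intersection A B p hp B' hB' (Finset.mem_inter.2 ⟨hx, hxB⟩)
    · exact hxB
  · left
    refine hG.eq_of_subset fun x hx => ?_
    rcases Finset.mem_union.1 (h hx) with hxB | hxB
    · exact hxB
    -- If the path from `A` to `B` avoids `B'`, appending the link gives a path from `A` to `B'`
    -- through `B`, so the part of `A` in `B'` also lies in `B`.
    · refine hG.running_intersection A B' (p.concat hadj) (hp.concat hB' hadj) B ?_
        (Finset.mem_inter.2 ⟨hx, hxB⟩)
      rw [SimpleGraph.Walk.support_concat]
      exact List.mem_append_left _ p.end_mem_support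

variable [Fintype ι] [Fintype κ] {H : SimpleGraph κ} {cl' : κ → Finset V}

/-- The clusters of the next level enumerate the links of the current one. -/
theorem IsCherryLevel.exists_link_enumeration (hG : IsCherryLevel G cl k)
    (hinj : Function.Injective cl')
    (hcard : Fintype.card κ + 1 = Fintype.card ι)
    (hun : ∀ e, ∃ A B, G.Adj A B ∧ cl' e = cl A ∪ cl B) :
    ∃ s t : κ → ι, (∀ e, G.Adj (s e) (t e)) ∧ (∀ e, cl' e = cl (s e) ∪ cl (t e)) ∧
      ∀ ψ : ι → ι → ℝ, ∑ p ∈ adjPairs G, ψ p.1 p.2 = ∑ e, (ψ (s e) (t e) + ψ (t e) (s e)) := by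
  classical
  choose s t hadj hcl using hun
  refine ⟨s, t, hadj, hcl, fun ψ => ?_⟩
  -- A link determines the union of its ends, hence the cluster of the next level.
  have hdet : ∀ e e', s(s e, t e) = s(s e', t e') → e = e' := by
    intro e e' h
    refine hinj ?_
    rw [hcl, hcl]
    rcases Sym2.eq_iff.1 h with ⟨h1, h2⟩ | ⟨h1, h2⟩
    · rw [h1, h2]
    · rw [h1, h2, Finset.union_comm]
  have hi₁ : Function.Injective fun e => (s e, t e) := fun e e' h =>
    hdet e e' (congrArg (fun p : ι × ι => s(p.1, p.2)) h)
  have hi₂ : Function.Injective fun e => (t e, s e) := fun e e' h =>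
    hdet e e' ((Sym2.eq_swap).trans ((congrArg (fun p : ι × ι => s(p.1, p.2)) h).trans Sym2.eq_swap))
  have hdisj : Disjoint (Finset.univ.image fun e => (s e, t e))
      (Finset.univ.image fun e => (t e, s e)) := by
    rw [Finset.disjoint_left]
    rintro p hp hp'
    obtain ⟨e, -, rfl⟩ := Finset.mem_image.1 hp
    obtain ⟨e', -, h⟩ := Finset.mem_image.1 hp'
    have h1 : t e' = s e := congrArg Prod.fst h
    have h2 : s e' = t e := congrArg Prod.snd h
    have : e = e' := hdet e e' (by rw [h1, h2, Sym2.eq_swap])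
    subst this
    exact (hadj e).ne h1.symm
  have heq : adjPairs G = (Finset.univ.image fun e => (s e, t e)) ∪
      (Finset.univ.image fun e => (t e, s e)) := by
    symm
    -- The tree has as many links as the next level has clusters, so an injective choice of links
    -- exhausts them.
    refine Finset.eq_of_subset_of_card_le ?_ ?_
    · intro p hp
      rcases Finset.mem_union.1 hp with hp | hp
      · obtain ⟨e, -, rfl⟩ := Finset.mem_image.1 hp
        exact mem_adjPairs.2 (hadj e)
      · obtain ⟨e, -, rfl⟩ := Finset.mem_image.1 hp
        exact mem_adjPairs.2 (hadj e).symm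
    · rw [Finset.card_union_of_disjoint hdisj, Finset.card_image_of_injective _ hi₁,
        Finset.card_image_of_injective _ hi₂, Finset.card_univ]
      have := card_adjPairs hG.isTree
      omega
  rw [heq, Finset.sum_union hdisj, Finset.sum_image hi₁.injOn, Finset.sum_image hi₂.injOn,
    Finset.sum_add_distrib]

/-- The separators of the next level are the clusters `A` of the current one, each occurring
`degree A - 1` times. -/
theorem IsCherryLevel.sum_separators (hG : IsCherryLevel G cl k)
    (hH : IsCherryLevel H cl' (k + 1)) (hcard : Fintype.card κ + 1 = Fintype.card ι)
    (hun : ∀ e, ∃ A B, G.Adj A B ∧ cl' e = cl A ∪ cl B) [DecidableRel G.Adj]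
    (φ : Finset V → ℝ) :
    ∑ p ∈ adjPairs H, φ (cl' p.1 ∩ cl' p.2) = ∑ A, (2 * (G.degree A : ℝ) - 2) * φ (cl A) := by
  classical
  obtain ⟨s, t, hadj, hcl, hsum⟩ := hG.exists_link_enumeration hH.injective hcard hun
  have hne : Nonempty κ := hH.isTree.connected.nonempty
  have hnt : Nontrivial ι := by
    rw [← Fintype.one_lt_card_iff_nontrivial]
    have := Fintype.card_pos (α := κ)
    omega
  -- A next-level cluster contains `cl A` exactly when the link it comes from ends at `A`.
  have hdeg : ∀ A, G.degree A = (Finset.univ.filter fun e => cl A ⊆ cl' e).card := by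
    intro A
    have h1 := sum_adjPairs_fst G fun a => if a = A then 1 else 0
    have h2 := hsum fun a _ => if a = A then 1 else 0
    rw [h2] at h1
    simp only [mul_ite, mul_one, mul_zero, Finset.sum_ite_eq', Finset.mem_univ, if_true] at h1
    have h3 : ((Finset.univ.filter fun e => cl A ⊆ cl' e).card : ℝ) = G.degree A := by
      rw [← h1, Finset.card_filter, Nat.cast_sum]
      refine Finset.sum_congr rfl fun e _ => ?_
      have hst := (hadj e).ne
      by_cases hA : cl A ⊆ cl' e
      · have hA' := hA
        rw [hcl] at hA'
        rcases hG.eq_or_eq_of_subset_union (hadj e) hA' with rfl | rfl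
        · simp [hA, hst.symm]
        · simp [hA, hst]
      · have h4 : s e ≠ A := fun h => hA (by rw [hcl, ← h]; exact Finset.subset_union_left)
        have h5 : t e ≠ A := fun h => hA (by rw [hcl, ← h]; exact Finset.subset_union_right)
        simp [hA, h4, h5]
    exact_mod_cast h3.symm
  -- Running intersection keeps the path between two such clusters inside the set, so the induced
  -- forest is connected.
  have htree : ∀ A, (H.induce {e | cl A ⊆ cl' e}).IsTree := by
    intro A
    refine ⟨?_, hH.isTree.isAcyclic.induce _⟩
    have hpos : 0 < G.degree A := hG.isTree.connected.preconnected.degree_pos_of_nontrivial A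
    rw [hdeg, Finset.card_pos] at hpos
    obtain ⟨e₀, he₀⟩ := hpos
    have : Nonempty {e | cl A ⊆ cl' e} := ⟨⟨e₀, (Finset.mem_filter.1 he₀).2⟩⟩
    refine ⟨fun e e' => ?_⟩
    obtain ⟨p, hp⟩ := hH.isTree.connected.exists_isPath e.1 e'.1
    exact ⟨p.induce {e | cl A ⊆ cl' e} fun K hK =>
      (Finset.subset_inter e.2 e'.2).trans (hH.running_intersection _ _ p hp K hK)⟩
  -- Separators of `H` have size `k`, so a link has separator `cl A` as soon as both its ends
  -- contain `cl A`. These are the links of a tree with `degree A` nodes, counted in both orders.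
  have hcount : ∀ A, ((adjPairs H).filter fun p => cl' p.1 ∩ cl' p.2 = cl A).card + 2 =
      2 * G.degree A := by
    intro A
    have h := card_adjPairs_filter _ (htree A)
    rw [hdeg]
    convert h using 3
    refine Finset.filter_congr fun p hp => ?_
    have hsep := hH.card_separator _ _ (mem_adjPairs.1 hp)
    constructor
    · intro h
      exact ⟨h ▸ Finset.inter_subset_left, h ▸ Finset.inter_subset_right⟩
    · rintro ⟨h1, h2⟩
      symm
      refine Finset.eq_of_subset_of_card_le (Finset.subset_inter h1 h2) ?_
      rw [hG.card_cluster]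
      omega
  have hdisj : ((Finset.univ : Finset ι) : Set ι).PairwiseDisjoint
      fun A => (adjPairs H).filter fun p => cl' p.1 ∩ cl' p.2 = cl A := by
    intro A _ B _ hAB
    refine Finset.disjoint_left.2 fun p hp hp' => hAB (hG.injective ?_)
    rw [← (Finset.mem_filter.1 hp).2, (Finset.mem_filter.1 hp').2]
  -- No other separators occur: with n the number of nodes of `G`, the sum of 2 deg A - 2 is 4(n -
  -- 1) - 2n = 2(n - 1) - 2, the number of ordered links of `H`.
  have hcover : (Finset.univ.biUnion fun A =>
      (adjPairs H).filter fun p => cl' p.1 ∩ cl' p.2 = cl A) = adjPairs H := by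
    refine Finset.eq_of_subset_of_card_le
      (Finset.biUnion_subset.2 fun A _ => Finset.filter_subset _ _) ?_
    rw [Finset.card_biUnion fun A hA B hB h => hdisj (Finset.mem_coe.2 hA) (Finset.mem_coe.2 hB) h]
    have h1 : ∑ A, (((adjPairs H).filter fun p => cl' p.1 ∩ cl' p.2 = cl A).card + 2) =
        ∑ A, 2 * G.degree A := Finset.sum_congr rfl fun A _ => hcount A
    rw [Finset.sum_add_distrib, ← Finset.mul_sum, G.sum_degrees_eq_twice_card_edges] at h1
    have h2 := hG.isTree.card_edgeFinset
    have h3 := card_adjPairs hH.isTree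
    simp only [Finset.sum_const, Finset.card_univ, smul_eq_mul] at h1
    omega
  rw [← hcover, Finset.sum_biUnion hdisj]
  refine Finset.sum_congr rfl fun A _ => ?_
  rw [Finset.sum_congr rfl fun p hp => by rw [(Finset.mem_filter.1 hp).2], Finset.sum_const,
    nsmul_eq_mul]
  congr 1
  have := hcount A
  have h : ((((adjPairs H).filter fun p => cl' p.1 ∩ cl' p.2 = cl A).card : ℕ) : ℝ) + 2 =
      2 * G.degree A := by exact_mod_cast this
  linarith

/-- The telescoping step: the difference of the cluster-minus-separator sums of two consecutive
levels is the sum of the interaction terms over the links. -/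
theorem IsCherryLevel.sum_step (hG : IsCherryLevel G cl k)
    (hH : IsCherryLevel H cl' (k + 1)) (hcard : Fintype.card κ + 1 = Fintype.card ι)
    (hun : ∀ e, ∃ A B, G.Adj A B ∧ cl' e = cl A ∪ cl B) (φ : Finset V → ℝ) :
    2 * ∑ e, φ (cl' e) - ∑ p ∈ adjPairs H, φ (cl' p.1 ∩ cl' p.2) =
      2 * ∑ A, φ (cl A) - ∑ p ∈ adjPairs G, φ (cl p.1 ∩ cl p.2) +
      ∑ p ∈ adjPairs G, (φ (cl p.1 ∪ cl p.2) + φ (cl p.1 ∩ cl p.2) - φ (cl p.1) - φ (cl p.2)) := by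
  classical
  obtain ⟨s, t, -, hcl, hsum⟩ := hG.exists_link_enumeration hH.injective hcard hun
  have h1 : ∑ p ∈ adjPairs G, φ (cl p.1 ∪ cl p.2) = 2 * ∑ e, φ (cl' e) := by
    rw [hsum fun a b => φ (cl a ∪ cl b), Finset.mul_sum]
    refine Finset.sum_congr rfl fun e _ => ?_
    rw [hcl, Finset.union_comm (cl (t e))]
    ring
  have h2 := sum_adjPairs_fst G fun a => φ (cl a)
  have h3 := sum_adjPairs_swap G fun a _ => φ (cl a)
  -- The degree-weighted cluster sums from the separators of `H` cancel those in the interactions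
  -- over `G`, leaving twice the plain cluster sum.
  have h4 := hG.sum_separators hH hcard hun φ
  simp only [sub_mul, mul_assoc, Finset.sum_sub_distrib, ← Finset.mul_sum] at h4
  simp only [Finset.sum_sub_distrib, Finset.sum_add_distrib]
  rw [h4, h3, h2, h1]
  ring

end CherryTrees

/-! ### The levels of a vine, and the passage from ordered to unordered links. -/

section VineLevels

/-- The bottom of the telescope: the first tree becomes a level of order 1, with empty separators.
-/
theorem isCherryLevel_singleton {V : Type*} [DecidableEq V] {G : SimpleGraph V} (hG : G.IsTree) :
    IsCherryLevel G (fun v : V => ({v} : Finset V)) 1 where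
  isTree := hG
  injective := Finset.singleton_injective
  card_cluster _ := Finset.card_singleton _
  card_separator A B h := by
    rw [Finset.singleton_inter_of_notMem (by simpa using h.ne), Finset.card_empty]
  running_intersection A B p hp K hK := by
    by_cases h : A = B
    · subst h
      have : K = A := by
        simpa [SimpleGraph.Walk.nil_iff_support_eq.1 (SimpleGraph.Walk.isPath_iff_nil.1 hp)] using hK
      subst this
      exact Finset.inter_subset_left
    · rw [Finset.singleton_inter_of_notMem (by simpa using h)]
      exact Finset.empty_subset _

theorem JunctionTree.IsCherry.isCherryLevel {V : Type*} [DecidableEq V] {T : JunctionTree V}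
    {k : ℕ} (hT : T.IsCherry k) : IsCherryLevel T.link (fun A => A.1) k where
  isTree := T.isTree
  injective := Subtype.val_injective
  card_cluster A := hT.card_cluster A.1 A.2
  card_separator := hT.card_separator
  running_intersection := T.running_intersection

/-- The top of the telescope: a formal level of order d above the last tree, with one cluster and no
links. -/
theorem isCherryLevel_univ (V : Type*) [DecidableEq V] [Fintype V] :
    IsCherryLevel (⊥ : SimpleGraph Unit) (fun _ => (Finset.univ : Finset V))
      (Fintype.card V) where
  isTree := ⟨⟨fun _ _ => SimpleGraph.Reachable.refl _⟩, SimpleGraph.isAcyclic_bot⟩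
  injective _ _ _ := rfl
  card_cluster _ := Finset.card_univ
  card_separator _ _ h := absurd h (by simp)
  running_intersection _ _ _ _ _ _ := Finset.subset_univ _

/-- Two nodes carry a single link, and its union has k + k - (k - 1) = k + 1 elements. -/
theorem IsCherryLevel.exists_union_eq_univ {V ι : Type*} [DecidableEq V] [Fintype V] [Fintype ι]
    {G : SimpleGraph ι} {cl : ι → Finset V} {k : ℕ} (hG : IsCherryLevel G cl k)
    (hι : Fintype.card ι = 2) (hk : k + 1 = Fintype.card V) :
    ∃ A B, G.Adj A B ∧ Finset.univ = cl A ∪ cl B := by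
  have h := card_adjPairs hG.isTree
  obtain ⟨p, hp⟩ : (adjPairs G).Nonempty := Finset.card_pos.1 (by omega)
  refine ⟨p.1, p.2, mem_adjPairs.1 hp, ?_⟩
  symm
  refine Finset.eq_univ_of_card _ ?_
  have h1 := Finset.card_union_add_card_inter (cl p.1) (cl p.2)
  have h2 := hG.card_separator _ _ (mem_adjPairs.1 hp)
  rw [hG.card_cluster, hG.card_cluster] at h1
  omega

theorem sum_adjPairs_eq_two_mul {ι : Type*} [Fintype ι] (G : SimpleGraph ι) (q : ι → ι → Prop)
    [DecidablePred fun p : ι × ι => q p.1 p.2] (hq : ∀ a b, G.Adj a b → (q a b ↔ ¬ q b a))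
    (ψ : ι → ι → ℝ) (hψ : ∀ a b, ψ a b = ψ b a) :
    ∑ p ∈ adjPairs G, ψ p.1 p.2 = 2 * ∑ p ∈ (adjPairs G).filter (fun p => q p.1 p.2), ψ p.1 p.2 := by
  have h : ∑ p ∈ (adjPairs G).filter (fun p => ¬ q p.1 p.2), ψ p.1 p.2 =
      ∑ p ∈ (adjPairs G).filter (fun p => q p.1 p.2), ψ p.1 p.2 := by
    refine Finset.sum_nbij' Prod.swap Prod.swap ?_ ?_ (fun _ _ => rfl) (fun _ _ => rfl)
      (fun _ _ => hψ _ _)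
    · intro p hp
      obtain ⟨hp, hn⟩ := Finset.mem_filter.1 hp
      have hadj := mem_adjPairs.1 hp
      exact Finset.mem_filter.2 ⟨mem_adjPairs.2 hadj.symm, (hq _ _ hadj.symm).2 hn⟩
    · intro p hp
      obtain ⟨hp, hn⟩ := Finset.mem_filter.1 hp
      have hadj := mem_adjPairs.1 hp
      exact Finset.mem_filter.2 ⟨mem_adjPairs.2 hadj.symm, (hq _ _ hadj).1 hn⟩
  rw [← Finset.sum_filter_add_sum_filter_not (adjPairs G) (fun p => q p.1 p.2), h]
  ring

theorem sum_adjPairs_eq_sum_edgePairs {d : ℕ} (G : SimpleGraph (Fin d)) (ψ : Fin d → Fin d → ℝ)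
    (hψ : ∀ a b, ψ a b = ψ b a) :
    ∑ p ∈ adjPairs G, ψ p.1 p.2 = 2 * ∑ e ∈ edgePairs G, ψ e.1 e.2 := by
  classical
  rw [sum_adjPairs_eq_two_mul G (· < ·) (fun a b h => ?_) ψ hψ]
  · congr 2
    ext p
    simp [edgePairs, mem_adjPairs, and_comm]
  · rw [not_lt]
    exact ⟨le_of_lt, fun hle => lt_of_le_of_ne hle h.ne⟩

variable {d : ℕ} {T : JunctionTree (Fin d)} {k : ℕ}

theorem mem_linkTriples {e : Fin d × Fin d × Finset (Fin d)} : e ∈ linkTriples T ↔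
    e.1 < e.2.1 ∧ ∃ A B, T.link.Adj A B ∧ e.2.2 = A.1 ∩ B.1 ∧ A.1 \ e.2.2 = {e.1} ∧
      B.1 \ e.2.2 = {e.2.1} := by
  simp only [linkTriples, Finset.mem_filter, Finset.mem_univ, true_and]

theorem exists_of_mem_linkTriples {e : Fin d × Fin d × Finset (Fin d)} (he : e ∈ linkTriples T) :
    e.1 ≠ e.2.1 ∧ e.1 ∉ e.2.2 ∧ e.2.1 ∉ e.2.2 ∧ ∃ p : T.clusters × T.clusters,
      T.link.Adj p.1 p.2 ∧ p.1.1 ∩ p.2.1 = e.2.2 ∧ p.1.1 \ e.2.2 = {e.1} ∧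
      p.2.1 \ e.2.2 = {e.2.1} ∧ p.1.1 = e.2.2 ∪ {e.1} ∧ p.2.1 = e.2.2 ∪ {e.2.1} := by
  obtain ⟨hlt, A, B, hadj, hS, ha, hb⟩ := mem_linkTriples.1 he
  refine ⟨hlt.ne, ?_, ?_, (A, B), hadj, hS.symm, ha, hb, ?_, ?_⟩
  · exact (Finset.mem_sdiff.1 (ha ▸ Finset.mem_singleton_self e.1 : e.1 ∈ A.1 \ e.2.2)).2
  · exact (Finset.mem_sdiff.1 (hb ▸ Finset.mem_singleton_self e.2.1 : e.2.1 ∈ B.1 \ e.2.2)).2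
  · rw [← ha, Finset.union_sdiff_of_subset (hS ▸ Finset.inter_subset_left)]
  · rw [← hb, Finset.union_sdiff_of_subset (hS ▸ Finset.inter_subset_right)]

/-- The linked clusters `A`, `B`, in the order in which they are listed in `linkTriples`. -/
def IsOrderedLink (A B : T.clusters) : Prop :=
  ∃ a b, a < b ∧ A.1 \ (A.1 ∩ B.1) = {a} ∧ B.1 \ (A.1 ∩ B.1) = {b}

/-- Each end exceeds the separator by one element, and these two elements are distinct, so exactly
one order lists the smaller first. This makes the triples a half of the ordered links. -/
theorem JunctionTree.IsCherry.isOrderedLink_iff (hT : T.IsCherry k) {A B : T.clusters}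
    (h : T.link.Adj A B) : IsOrderedLink A B ↔ ¬ IsOrderedLink B A := by
  have hsep := hT.card_separator A B h
  have key : ∀ (A B : T.clusters), (A.1 ∩ B.1).card + 1 = k → ∃ a, A.1 \ (A.1 ∩ B.1) = {a} := by
    intro A B hAB
    rw [← Finset.card_eq_one]
    have := Finset.card_sdiff_add_card_eq_card (Finset.inter_subset_left (s₁ := A.1) (s₂ := B.1))
    rw [hT.card_cluster A.1 A.2] at this
    omega
  obtain ⟨a, ha⟩ := key A B hsep
  obtain ⟨b, hb⟩ := key B A (by rw [Finset.inter_comm]; exact hsep)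
  rw [Finset.inter_comm] at hb
  have hab : a ≠ b := by
    rintro rfl
    have h1 : a ∈ A.1 \ (A.1 ∩ B.1) := ha ▸ Finset.mem_singleton_self a
    have h2 : a ∈ B.1 \ (A.1 ∩ B.1) := hb ▸ Finset.mem_singleton_self a
    rw [Finset.mem_sdiff] at h1 h2
    exact h1.2 (Finset.mem_inter.2 ⟨h1.1, h2.1⟩)
  have h1 : IsOrderedLink A B ↔ a < b := by
    constructor
    · rintro ⟨a', b', hlt, ha', hb'⟩
      rw [Finset.singleton_injective (ha.symm.trans ha'),
        Finset.singleton_injective (hb.symm.trans hb')]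
      exact hlt
    · exact fun hlt => ⟨a, b, hlt, ha, hb⟩
  have h2 : IsOrderedLink B A ↔ b < a := by
    rw [IsOrderedLink, Finset.inter_comm]
    constructor
    · rintro ⟨a', b', hlt, ha', hb'⟩
      rw [Finset.singleton_injective (ha.symm.trans hb'),
        Finset.singleton_injective (hb.symm.trans ha')]
      exact hlt
    · exact fun hlt => ⟨b, a, hlt, hb, ha⟩
  rw [h1, h2, not_lt]
  exact ⟨le_of_lt, fun hle => lt_of_le_of_ne hle hab⟩

theorem JunctionTree.IsCherry.sum_adjPairs_eq_sum_linkTriples (hT : T.IsCherry k)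
    (ψ : Finset (Fin d) → Finset (Fin d) → ℝ) (hψ : ∀ A B, ψ A B = ψ B A) :
    ∑ p ∈ adjPairs T.link, ψ p.1.1 p.2.1 =
      2 * ∑ e ∈ linkTriples T, ψ (e.2.2 ∪ {e.1}) (e.2.2 ∪ {e.2.1}) := by
  classical
  rw [sum_adjPairs_eq_two_mul T.link IsOrderedLink (fun A B h => hT.isOrderedLink_iff h)
    (fun A B => ψ A.1 B.1) fun A B => hψ _ _]
  congr 1
  symm
  have hex := fun e (he : e ∈ linkTriples T) => (exists_of_mem_linkTriples he).2.2.2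
  choose f hf using hex
  refine Finset.sum_bij f ?_ ?_ ?_ ?_
  · intro e he
    obtain ⟨hadj, hS, ha, hb, -, -⟩ := hf e he
    refine Finset.mem_filter.2 ⟨mem_adjPairs.2 hadj, e.1, e.2.1, (mem_linkTriples.1 he).1, ?_, ?_⟩
    · rw [hS]; exact ha
    · rw [hS]; exact hb
  · intro e he e' he' h
    obtain ⟨-, hS, ha, hb, -, -⟩ := hf e he
    obtain ⟨-, hS', ha', hb', -, -⟩ := hf e' he'
    rw [h] at hS ha hb
    have h1 : e.2.2 = e'.2.2 := hS.symm.trans hS'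
    rw [h1] at ha hb
    exact Prod.ext (Finset.singleton_injective (ha.symm.trans ha'))
      (Prod.ext (Finset.singleton_injective (hb.symm.trans hb')) h1)
  · intro p hp
    obtain ⟨hp, a, b, hlt, ha, hb⟩ := Finset.mem_filter.1 hp
    have he : (a, b, p.1.1 ∩ p.2.1) ∈ linkTriples T := mem_linkTriples.2
      ⟨hlt, p.1, p.2, mem_adjPairs.1 hp, rfl, ha, hb⟩
    refine ⟨_, he, ?_⟩
    obtain ⟨-, -, -, -, h1, h2⟩ := hf _ he
    refine Prod.ext (Subtype.ext ?_) (Subtype.ext ?_)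
    · rw [h1]
      dsimp only
      rw [← ha, Finset.union_sdiff_of_subset Finset.inter_subset_left]
    · rw [h2]
      dsimp only
      rw [← hb, Finset.union_sdiff_of_subset Finset.inter_subset_right]
  · intro e he
    obtain ⟨-, -, -, -, h1, h2⟩ := hf e he
    rw [h1, h2]

/-- Every pair of linked clusters is listed in `linkTriples`, in one of the two orders. -/
theorem JunctionTree.IsCherry.exists_mem_linkTriples (hT : T.IsCherry k) {A B : T.clusters}
    (h : T.link.Adj A B) : ∃ e ∈ linkTriples T,
      (A.1 = e.2.2 ∪ {e.1} ∧ B.1 = e.2.2 ∪ {e.2.1}) ∨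
      (B.1 = e.2.2 ∪ {e.1} ∧ A.1 = e.2.2 ∪ {e.2.1}) := by
  have key : ∀ {A B : T.clusters}, T.link.Adj A B → IsOrderedLink A B → ∃ e ∈ linkTriples T,
      A.1 = e.2.2 ∪ {e.1} ∧ B.1 = e.2.2 ∪ {e.2.1} := by
    rintro A B h ⟨a, b, hlt, ha, hb⟩
    refine ⟨(a, b, A.1 ∩ B.1), mem_linkTriples.2
      ⟨hlt, A, B, h, rfl, ha, hb⟩, ?_, ?_⟩
    · dsimp only
      rw [← ha, Finset.union_sdiff_of_subset Finset.inter_subset_left]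
    · dsimp only
      rw [← hb, Finset.union_sdiff_of_subset Finset.inter_subset_right]
  by_cases ho : IsOrderedLink A B
  · obtain ⟨e, he, h'⟩ := key h ho
    exact ⟨e, he, Or.inl h'⟩
  · have ho' : IsOrderedLink B A := (hT.isOrderedLink_iff h.symm).2 ho
    obtain ⟨e, he, h'⟩ := key h.symm ho'
    exact ⟨e, he, Or.inr h'⟩

/-- The interaction term of two sets for a set function. -/
def interaction {V : Type*} [DecidableEq V] (φ : Finset V → ℝ) (A B : Finset V) : ℝ :=
  φ (A ∪ B) + φ (A ∩ B) - φ A - φ B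

theorem interaction_comm {V : Type*} [DecidableEq V] (φ : Finset V → ℝ) (A B : Finset V) :
    interaction φ A B = interaction φ B A := by
  rw [interaction, interaction, Finset.union_comm, Finset.inter_comm]
  ring

end VineLevels

/-! ### Telescoping over the vine. -/

namespace CherryVine

variable {d : ℕ} (T : CherryVine d)

include T in
theorem pos : 0 < d := Fin.pos_iff_nonempty.2 T.firstTree_isTree.connected.nonempty

theorem exists_singletons_union (hd : 3 ≤ d) (e : (T.tree 2).clusters) :
    ∃ l m, T.firstTree.Adj l m ∧ e.1 = {l} ∪ {m} := by
  obtain ⟨l, m, h, he⟩ := (T.clusters_two hd e.1).1 e.2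
  exact ⟨l, m, h, he.trans (Finset.insert_eq l {m})⟩

theorem exists_univ_eq_singletons (hd : d = 2) :
    ∃ l m, T.firstTree.Adj l m ∧ (Finset.univ : Finset (Fin d)) = {l} ∪ {m} :=
  (isCherryLevel_singleton T.firstTree_isTree).exists_union_eq_univ (by simp [hd]) (by simp [hd])

theorem exists_univ_eq_union (hd : 3 ≤ d) : ∃ A B, (T.tree (d - 1)).link.Adj A B ∧
    (Finset.univ : Finset (Fin d)) = A.1 ∪ B.1 := by
  have hc := T.card_clusters (d - 1) (by omega) (by omega)
  exact (T.isCherry (d - 1) (by omega) (by omega)).isCherryLevel.exists_union_eq_univ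
    (by rw [Fintype.card_coe]; omega) (by rw [Fintype.card_fin]; omega)

/-- A property of sets that holds for singletons and passes to unions of linked clusters holds for
the set of all vertices. -/
theorem univ_induction {p : Finset (Fin d) → Prop} (h1 : ∀ i, p {i})
    (h2 : ∀ l m, T.firstTree.Adj l m → p {l} → p {m} → p ({l} ∪ {m}))
    (h3 : ∀ k, 2 ≤ k → k + 1 ≤ d → ∀ A B, (T.tree k).link.Adj A B → p A.1 → p B.1 →
      p (A.1 ∪ B.1)) : p Finset.univ := by
  have hpos := T.pos
  rcases Nat.lt_or_ge d 3 with hd | hd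
  · rcases (by omega : d = 1 ∨ d = 2) with rfl | hd
    · exact h1 0
    · obtain ⟨l, m, h, hu⟩ := T.exists_univ_eq_singletons hd
      rw [hu]
      exact h2 l m h (h1 l) (h1 m)
  · have hk : ∀ k, 2 ≤ k → k + 1 ≤ d → ∀ A ∈ (T.tree k).clusters, p A := by
      intro k hk
      induction k, hk using Nat.le_induction with
      | base =>
        intro _ A hA
        obtain ⟨l, m, h, he⟩ := T.exists_singletons_union hd ⟨A, hA⟩
        have he' : A = {l} ∪ {m} := he
        rw [he']
        exact h2 l m h (h1 l) (h1 m)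
      | succ k hk ih =>
        intro hkd A hA
        obtain ⟨B, B', h, he⟩ := T.clusters_succ k hk hkd A hA
        rw [he]
        exact h3 k hk (by omega) B B' h (ih (by omega) _ B.2) (ih (by omega) _ B'.2)
    obtain ⟨A, B, h, hu⟩ := T.exists_univ_eq_union hd
    rw [hu]
    exact h3 (d - 1) (by omega) (by omega) A B h (hk _ (by omega) (by omega) _ A.2)
      (hk _ (by omega) (by omega) _ B.2)

/-- The vine decomposition of a set function into main terms and interaction terms. -/
theorem sum_decomposition (φ : Finset (Fin d) → ℝ) (h0 : φ ∅ = 0) :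
    φ Finset.univ = ∑ i, φ {i} + ∑ e ∈ edgePairs T.firstTree, interaction φ {e.1} {e.2} +
      ∑ k ∈ Finset.Icc 2 (d - 1), ∑ e ∈ linkTriples (T.tree k),
        interaction φ (e.2.2 ∪ {e.1}) (e.2.2 ∪ {e.2.1}) := by
  have hpos := T.pos
  have hL1 := isCherryLevel_singleton T.firstTree_isTree
  have hE := sum_adjPairs_eq_sum_edgePairs T.firstTree (fun a b => interaction φ {a} {b})
    fun a b => interaction_comm φ _ _
  have hsep : ∑ p ∈ adjPairs T.firstTree, φ ({p.1} ∩ {p.2}) = 0 := by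
    refine Finset.sum_eq_zero fun p hp => ?_
    rw [Finset.singleton_inter_of_notMem (by simpa using (mem_adjPairs.1 hp).ne), h0]
  have hbot : ∑ p ∈ adjPairs (⊥ : SimpleGraph Unit),
      φ ((fun _ => Finset.univ) p.1 ∩ (fun _ => Finset.univ) p.2) = 0 := by
    refine Finset.sum_eq_zero fun p hp => absurd (mem_adjPairs.1 hp) (by simp)
  have hcd : Fintype.card (Fin d) = d := Fintype.card_fin d
  rcases Nat.lt_or_ge d 3 with hd | hd
  -- Here there is no second tree: for d = 1 nothing is linked, and for d = 2 the formal top level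
  -- follows the first tree directly.
  · rcases (by omega : d = 1 ∨ d = 2) with rfl | hd
    · have h1 : edgePairs T.firstTree = ∅ := by
        refine Finset.eq_empty_of_forall_notMem fun e he => ?_
        simp only [edgePairs, Finset.mem_filter] at he
        have := he.2.1
        rw [Subsingleton.elim e.1 e.2] at this
        exact lt_irrefl _ this
      rw [h1]
      simp
    · have hst := hL1.sum_step (H := (⊥ : SimpleGraph Unit)) (cl' := fun _ => Finset.univ)
        (by
          have e : Fintype.card (Fin d) = 1 + 1 := by rw [hcd, hd]
          have := isCherryLevel_univ (Fin d)
          rw [e] at this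
          exact this)
        (by rw [hcd, hd]; rfl) (fun _ => T.exists_univ_eq_singletons hd) φ
      have hI : Finset.Icc 2 (d - 1) = ∅ := Finset.Icc_eq_empty (by omega)
      rw [hI, Finset.sum_empty]
      rw [hbot, hsep] at hst
      simp only [interaction] at hE hst ⊢
      rw [hE] at hst
      simp only [Finset.univ_unique, Finset.sum_const, Finset.card_singleton, one_smul] at hst
      linarith
  -- The telescoping quantity; the factor 2 matches links being counted in both orders.
  · set Γ : ℕ → ℝ := fun k => 2 * ∑ A : (T.tree k).clusters, φ A.1 -
      ∑ p ∈ adjPairs (T.tree k).link, φ (p.1.1 ∩ p.2.1) with hΓ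
    set Δ : ℕ → ℝ := fun k => ∑ e ∈ linkTriples (T.tree k),
      interaction φ (e.2.2 ∪ {e.1}) (e.2.2 ∪ {e.2.1}) with hΔ
    have hΔ' : ∀ k, 2 ≤ k → k + 1 ≤ d →
        ∑ p ∈ adjPairs (T.tree k).link, interaction φ p.1.1 p.2.1 = 2 * Δ k := fun k h1 h2 =>
      (T.isCherry k h1 h2).sum_adjPairs_eq_sum_linkTriples (interaction φ) (interaction_comm φ)
    have hstep1 : Γ 2 = 2 * ∑ i, φ {i} +
        2 * ∑ e ∈ edgePairs T.firstTree, interaction φ {e.1} {e.2} := by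
      have hst := hL1.sum_step (T.isCherry 2 le_rfl hd).isCherryLevel
        (by rw [hcd, Fintype.card_coe]; have := T.card_clusters 2 le_rfl hd; omega)
        (T.exists_singletons_union hd) φ
      rw [hsep, sub_zero] at hst
      rw [← hE]
      exact hst
    have hstep : ∀ k, 2 ≤ k → k + 2 ≤ d → Γ (k + 1) = Γ k + 2 * Δ k := by
      intro k h1 h2
      have hst := (T.isCherry k h1 (by omega)).isCherryLevel.sum_step
        (T.isCherry (k + 1) (by omega) h2).isCherryLevel
        (by
          rw [Fintype.card_coe, Fintype.card_coe]
          have := T.card_clusters k h1 (by omega)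
          have := T.card_clusters (k + 1) (by omega) h2
          omega)
        (fun e => T.clusters_succ k h1 h2 e.1 e.2) φ
      rw [← hΔ' k h1 (by omega)]
      exact hst
    have htop : 2 * φ Finset.univ = Γ (d - 1) + 2 * Δ (d - 1) := by
      have hst := (T.isCherry (d - 1) (by omega) (by omega)).isCherryLevel.sum_step
        (H := (⊥ : SimpleGraph Unit)) (cl' := fun _ => Finset.univ)
        (by
          have := isCherryLevel_univ (Fin d)
          have e : Fintype.card (Fin d) = d - 1 + 1 := by rw [hcd]; omega
          rw [e] at this
          exact this)
        (by
          rw [Fintype.card_coe]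
          have := T.card_clusters (d - 1) (by omega) (by omega)
          rw [Fintype.card_unit]
          omega)
        (fun _ => T.exists_univ_eq_union hd) φ
      rw [hbot, sub_zero] at hst
      simp only [Finset.univ_unique, Finset.sum_const, Finset.card_singleton, one_smul] at hst
      rw [← hΔ' (d - 1) (by omega) (by omega)]
      exact hst
    have hsum : ∀ k, 2 ≤ k → k + 1 ≤ d → Γ k = Γ 2 + 2 * ∑ j ∈ Finset.Ico 2 k, Δ j := by
      intro k hk
      induction k, hk using Nat.le_induction with
      | base => intro _; simp
      | succ k hk ih =>
        intro hkd
        rw [hstep k hk hkd, ih (by omega), Finset.sum_Ico_succ_top hk]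
        ring
    have hIcc : Finset.Icc 2 (d - 1) = Finset.Ico 2 (d - 1 + 1) := by
      ext j; simp only [Finset.mem_Icc, Finset.mem_Ico]; omega
    rw [hIcc, Finset.sum_Ico_succ_top (by omega)]
    have h := hsum (d - 1) (by omega) (by omega)
    linarith

end CherryVine

/-! ### From set functions back to densities. -/

/-- The logarithm of the pair-copula density is the interaction term of the logarithms of the
marginal densities. -/
theorem log_toReal_eq_interaction {V : Type*} [DecidableEq V] {f : Finset V → ℝ≥0∞}
    (h0 : ∀ D, f D ≠ 0) (htop : ∀ D, f D ≠ ∞) {A B : Finset V} {c : ℝ≥0∞}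
    (h : f (A ∪ B) * f (A ∩ B) = f A * f B * c) :
    0 < c.toReal ∧ c ≠ ∞ ∧
      Real.log c.toReal = interaction (fun D => Real.log (f D).toReal) A B := by
  have hpos : ∀ D, 0 < (f D).toReal := fun D => ENNReal.toReal_pos (h0 D) (htop D)
  have hc0 : c ≠ 0 := by
    rintro rfl
    rw [mul_zero] at h
    exact mul_ne_zero (h0 _) (h0 _) h
  have hct : c ≠ ∞ := by
    rintro rfl
    rw [ENNReal.mul_top (mul_ne_zero (h0 _) (h0 _))] at h
    exact ENNReal.mul_ne_top (htop _) (htop _) h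
  have hc := ENNReal.toReal_pos hc0 hct
  refine ⟨hc, hct, ?_⟩
  have h' := congrArg (fun r => Real.log r.toReal) h
  simp only [ENNReal.toReal_mul] at h'
  rw [Real.log_mul (hpos _).ne' (hpos _).ne', Real.log_mul (mul_pos (hpos _) (hpos _)).ne' hc.ne',
    Real.log_mul (hpos _).ne' (hpos _).ne'] at h'
  simp only [interaction]
  linarith

/-- The vine factorization of a positive set function into singletons and link factors. -/
theorem CherryVine.prod_decomposition {d : ℕ} (T : CherryVine d) {f : Finset (Fin d) → ℝ≥0∞}
    (hempty : f ∅ = 1) (htop : ∀ D, f D ≠ ∞) (hpos : f Finset.univ ≠ 0 → ∀ D, f D ≠ 0)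
    {c : Fin d → Fin d → Finset (Fin d) → ℝ≥0∞}
    (h : ∀ a b S, a ≠ b → a ∉ S → b ∉ S →
      f (S ∪ {a} ∪ {b}) * f S = f (S ∪ {a}) * f (S ∪ {b}) * c a b S) :
    f Finset.univ = (∏ i, f {i}) * (∏ e ∈ edgePairs T.firstTree, c e.1 e.2 ∅) *
      ∏ k ∈ Finset.Icc 2 (d - 1), ∏ e ∈ linkTriples (T.tree k), c e.1 e.2.1 e.2.2 := by
  have hlink : ∀ a b S, a ≠ b → a ∉ S → b ∉ S →
      f ((S ∪ {a}) ∪ (S ∪ {b})) * f ((S ∪ {a}) ∩ (S ∪ {b})) =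
        f (S ∪ {a}) * f (S ∪ {b}) * c a b S := by
    intro a b S hab ha hb
    have h1 : (S ∪ {a}) ∪ (S ∪ {b}) = S ∪ {a} ∪ {b} := by
      ext x; simp only [Finset.mem_union]; tauto
    have h2 : (S ∪ {a}) ∩ (S ∪ {b}) = S := by
      rw [← Finset.union_inter_distrib_left,
        Finset.singleton_inter_of_notMem (by simpa using hab), Finset.union_empty]
    rw [h1, h2]
    exact h a b S hab ha hb
  have hedge : ∀ a b, a ≠ b → f ({a} ∪ {b}) * f ({a} ∩ {b}) = f {a} * f {b} * c a b ∅ := by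
    intro a b hab
    simpa using hlink a b ∅ hab (by simp) (by simp)
  by_cases hz : f Finset.univ = 0
  · rw [hz]
    symm
    by_contra hne
    rw [← ne_eq, mul_ne_zero_iff, mul_ne_zero_iff, Finset.prod_ne_zero_iff,
      Finset.prod_ne_zero_iff, Finset.prod_ne_zero_iff] at hne
    obtain ⟨⟨h1, h2⟩, h3⟩ := hne
    -- Were all factors nonzero, the pair identity would carry nonvanishing from two linked clusters
    -- to their union, and so up to the whole vertex set.
    refine T.univ_induction (p := fun D => f D ≠ 0) (fun i => h1 i (Finset.mem_univ i)) ?_ ?_ hz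
    · have key : ∀ l m, T.firstTree.Adj l m → l < m → f {l} ≠ 0 → f {m} ≠ 0 →
          f ({l} ∪ {m}) ≠ 0 := by
        intro l m hadj hlt hl hm
        have hmem : (l, m) ∈ edgePairs T.firstTree := by simp [edgePairs, hlt, hadj]
        exact left_ne_zero_of_mul (hedge l m hlt.ne ▸ mul_ne_zero (mul_ne_zero hl hm) (h2 _ hmem))
      intro l m hadj hl hm
      rcases lt_or_gt_of_ne hadj.ne with hlt | hlt
      · exact key l m hadj hlt hl hm
      · rw [Finset.union_comm]
        exact key m l hadj.symm hlt hm hl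
    · intro k hk hkd A B hadj hA hB
      obtain ⟨e, he, hAB⟩ := (T.isCherry k hk hkd).exists_mem_linkTriples hadj
      obtain ⟨hab, ha, hb, -⟩ := exists_of_mem_linkTriples he
      have h3' := h3 k (Finset.mem_Icc.2 ⟨hk, by omega⟩)
      rw [Finset.prod_ne_zero_iff] at h3'
      have hc := h3' e he
      have hl := hlink _ _ _ hab ha hb
      rcases hAB with ⟨h4, h5⟩ | ⟨h4, h5⟩
      · rw [← h4, ← h5] at hl
        exact left_ne_zero_of_mul (hl ▸ mul_ne_zero (mul_ne_zero hA hB) hc)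
      · rw [← h4, ← h5] at hl
        rw [Finset.union_comm]
        exact left_ne_zero_of_mul (hl ▸ mul_ne_zero (mul_ne_zero hB hA) hc)
  · have h0 := hpos hz
    have he1 : ∀ e ∈ edgePairs T.firstTree, 0 < (c e.1 e.2 ∅).toReal ∧ c e.1 e.2 ∅ ≠ ∞ ∧
        Real.log (c e.1 e.2 ∅).toReal =
          interaction (fun D => Real.log (f D).toReal) {e.1} {e.2} := by
      intro e he
      have hlt : e.1 < e.2 := by
        simp only [edgePairs, Finset.mem_filter] at he
        exact he.2.1
      exact log_toReal_eq_interaction h0 htop (hedge e.1 e.2 hlt.ne)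
    have he2 : ∀ k, ∀ e ∈ linkTriples (T.tree k), 0 < (c e.1 e.2.1 e.2.2).toReal ∧
        c e.1 e.2.1 e.2.2 ≠ ∞ ∧ Real.log (c e.1 e.2.1 e.2.2).toReal =
          interaction (fun D => Real.log (f D).toReal) (e.2.2 ∪ {e.1}) (e.2.2 ∪ {e.2.1}) := by
      intro k e he
      obtain ⟨hab, ha, hb, -⟩ := exists_of_mem_linkTriples he
      exact log_toReal_eq_interaction h0 htop (hlink _ _ _ hab ha hb)
    have hf : ∀ D, 0 < (f D).toReal := fun D => ENNReal.toReal_pos (h0 D) (htop D)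
    have hp1 : 0 < ∏ i : Fin d, (f {i}).toReal := Finset.prod_pos fun i _ => hf _
    have hp2 : 0 < ∏ e ∈ edgePairs T.firstTree, (c e.1 e.2 ∅).toReal :=
      Finset.prod_pos fun e he => (he1 e he).1
    have hp3 : ∀ k, 0 < ∏ e ∈ linkTriples (T.tree k), (c e.1 e.2.1 e.2.2).toReal := fun k =>
      Finset.prod_pos fun e he => (he2 k e he).1
    have hp4 : 0 < ∏ k ∈ Finset.Icc 2 (d - 1), ∏ e ∈ linkTriples (T.tree k),
        (c e.1 e.2.1 e.2.2).toReal := Finset.prod_pos fun k _ => hp3 k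
    -- All quantities are now positive and finite, so the product formula is the additive
    -- decomposition applied to log f, with φ(∅) = 0 because f(∅) = 1.
    refine (ENNReal.toReal_eq_toReal_iff' (htop _) ?_).1 ?_
    · exact ENNReal.mul_ne_top (ENNReal.mul_ne_top (ENNReal.prod_ne_top fun i _ => htop _)
        (ENNReal.prod_ne_top fun e he => (he1 e he).2.1))
        (ENNReal.prod_ne_top fun k _ => ENNReal.prod_ne_top fun e he => (he2 k e he).2.1)
    · simp only [ENNReal.toReal_mul, ENNReal.toReal_prod]
      refine Real.log_injOn_pos (hf _) (mul_pos (mul_pos hp1 hp2) hp4) ?_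
      rw [Real.log_mul (mul_pos hp1 hp2).ne' hp4.ne', Real.log_mul hp1.ne' hp2.ne',
        Real.log_prod fun i _ => (hf _).ne', Real.log_prod fun e he => (he1 e he).1.ne',
        Real.log_prod fun k _ => (hp3 k).ne',
        Finset.sum_congr rfl fun e he => (he1 e he).2.2,
        Finset.sum_congr rfl fun k _ => Real.log_prod fun e he => (he2 k e he).1.ne']
      rw [Finset.sum_congr rfl fun k _ => Finset.sum_congr rfl fun e he => (he2 k e he).2.2]
      exact T.sum_decomposition (fun D => Real.log (f D).toReal) (by simp [hempty])

theorem theorem4p2 {d : ℕ} {Ω : Type*} [MeasurableSpace Ω] (P : Measure Ω)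
    [IsProbabilityMeasure P] (X : Ω → Fin d → ℝ) (hX : HasPDF X P volume) (T : CherryVine d) :
    (∃ C c, IsPairCopulaFamily P X C c) ∧
    ∀ C c, IsPairCopulaFamily P X C c →
      -- the density decomposition
      (∀ᵐ x : Fin d → ℝ,
        pdf X P volume x =
          (∏ i : Fin d, pdf (fun ω => X ω i) P volume (x i)) *
          (∏ e ∈ edgePairs T.firstTree,
            c e.1 e.2 ∅ (cdf (P.map fun ω => X ω e.1) (x e.1))
              (cdf (P.map fun ω => X ω e.2) (x e.2)) (Finset.restrict ∅ x)) *
          ∏ k ∈ Finset.Icc 2 (d - 1), ∏ e ∈ linkTriples (T.tree k),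
            c e.1 e.2.1 e.2.2 (condDF P X e.1 e.2.2 (x e.1) (Finset.restrict e.2.2 x))
              (condDF P X e.2.1 e.2.2 (x e.2.1) (Finset.restrict e.2.2 x))
              (Finset.restrict e.2.2 x)) ∧
      -- the recursion for the conditional distribution functions
      (∀ (D : Finset (Fin d)) (i : Fin d) (hi : i ∈ D) (j : Fin d), j ∉ D →
        ∀ᵐ z : D → ℝ ∂(P.map fun ω => D.restrict (X ω)), ∀ t : ℝ,
          HasDerivAt
            (fun u => C i j (D.erase i) u
              (condDF P X j (D.erase i) t (Finset.restrict₂ (π := fun _ => ℝ) (Finset.erase_subset i D) z))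
              (Finset.restrict₂ (π := fun _ => ℝ) (Finset.erase_subset i D) z))
            (condDF P X j D t z)
            (condDF P X i (D.erase i) (z ⟨i, hi⟩)
              (Finset.restrict₂ (π := fun _ => ℝ) (Finset.erase_subset i D) z))) := by
  refine ⟨exists_isPairCopulaFamily hX, fun C c hCc => ⟨?_, ?_⟩⟩
  · filter_upwards [ae_marginalPDF_mul_eq hX hCc, ae_marginalPDF_ne_top hX,
      ae_marginalPDF_ne_zero hX, ae_marginalPDF_singleton hX, ae_marginalPDF_univ hX]
      with x hmul htop hpos hone huniv
    have h := T.prod_decomposition (f := fun D => marginalPDF P X D x) (marginalPDF_empty x) htop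
      (fun h => hpos (huniv ▸ h)) hmul
    simp only [huniv, hone, condDF_empty hX.aemeasurable] at h
    exact h
  · exact ae_hasDerivAt_pairCopula hX hCc
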